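/- Let $\mathfrak g$ be a finite-dimensional simple complex Lie algebra with Cartan subalgebra $\mathfrak h$, Weyl group $W$ and a choice of positive roots, and let $\rho\in\mathfrak h^*$ be half the sum of the positive roots. Let $\check{\mathfrak g}$ be the Langlands dual Lie algebra; identify $\mathfrak h^*$ with a Cartan subalgebra of $\check{\mathfrak g}$, so that the roots of $\mathfrak g$ are the coroots of $\check{\mathfrak g}$. Let $\check{\mathfrak b}=\mathfrak h^*\oplus\check{\mathfrak n}$ be the Borel subalgebra of $\check{\mathfrak g}$ given by the positive roots, and let $p_{-1}=\sum_i f_i$, where each $f_i$ is a nonzero vector in the root space of the $i$-th negative simple root of $\check{\mathfrak g}$. Let $\check G$ be the adjoint group of $\check{\mathfrak g}$, let $\check H$ and $\check N$ be its subgroups with Lie algebras $\mathfrak h^*$ and $\check{\mathfrak n}$, and regard $\rho$ as a cocharacter of $\check H$. For an integer $n\ge 1$ and $V$ a vector space or an affine variety, let $V_n$ denote the space of $\mathbb C[t]/t^n$-points of $V$. An oper (on the punctured disk) is an $\check N((t))$-conjugacy class of operators $\partial_t+p_{-1}+x(t)$ with $x(t)\in\check{\mathfrak b}((t))$. An oper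 with singularity of order at most $n$ is an $\check N[[t]]$-conjugacy class of operators $\partial_t+t^{-n}(p_{-1}+x(t))$ with $x(t)=\sum_{i\ge0}x_it^i\in\check{\mathfrak b}[[t]]$; it is regarded as an oper on the punctured disk through conjugation by $\rho(t)^{-n}$. Its $n$-th residue $\mathrm{Res}_n$ is the image of $p_{-1}+\sum_{i<n}x_it^i\in\check{\mathfrak g}_n$ in $$\check{\mathfrak g}_n/\check G_n:=\mathrm{Spec}\,\mathbb C[\check{\mathfrak g}_n]^{\check G_n}\simeq(\mathfrak h^*/W)_n,\qquad \mathfrak h^*/W=\mathrm{Spec}\,\mathbb C[\mathfrak h^*]^W .$$ This canonical identification is the one induced by restriction of functions $\mathbb C[\check{\mathfrak g}]^{\check G}\simeq\mathbb C[\mathfrak h^*]^W$ and by taking, for each $P\in\mathbb C[\check{\mathfrak g}]^{\check G}$, the coefficients of $t^k$ $(0\le k<n)$ in $x\mapsto P(x)$, $x\in\check{\mathfrak g}_n$. The Miura transformation sends an $\check H$-connection $\partial_t+v(t)$, $v(t)\in\mathfrak h^*((t))$, to the oper represented by $\partial_t+p_{-1}+v(t)$. Let $\varpi:\mathfrak h^*_n\to(\mathfrak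 h^*/W)_n$ be the canonical map, and let $\rho_n:=n\rho\,t^{n-1}\in\mathfrak h^*_n$ (under the pairing $\langle\Lambda,h\rangle\mapsto\mathrm{Res}_{t=0}\,t^{-n}\langle\Lambda,h\rangle\,dt$ of $\mathfrak h^*_n$ with $\mathfrak h_n$, this is the functional $\sum_i h_it^i\mapsto n\rho(h_0)$). **Lemma 3.1.** Let $\nabla=\partial_t+t^{-n}u(t)$, $u(t)=\sum_{i\ge0}u_it^i\in\mathfrak h^*[[t]]$, be an $\check H$-connection with a pole of order at most $n$, and put $\mathrm{Res}(u)=\sum_{i<n}u_it^i\in\mathfrak h^*_n$. Then the Miura transformation takes $\nabla$ to an oper with singularity of order at most $n$, whose $n$-th residue is well defined and equals $$\varpi\big(\mathrm{Res}(u)-\rho_n\big)\in(\mathfrak h^*/W)_n .$$ More precisely, in $\check{\mathfrak g}_n/\check G_n$ this residue is the image of $\mathrm{Res}(u)-\rho_n\in\mathfrak h^*_n\subset\check{\mathfrak g}_n$. -/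

import Mathlib

open scoped TensorProduct

noncomputable section

namespace IrregularOpers

/-! ### Unipotent and adjoint groups, as groups of automorphisms of a Lie algebra -/

section Groups

variable (A : Type*) [CommRing A] {M : Type*} [LieRing M] [LieAlgebra A M] [Module ℂ M]

/-- `s = exp (ad ν)`, where `ad ν` is nilpotent. -/
def IsExpAd (ν : M) (s : M ≃ₗ[A] M) : Prop :=
  ∃ m : ℕ, (LieAlgebra.ad A M ν) ^ m = 0 ∧
    ∀ x : M, s x = ∑ k ∈ Finset.range m, ((k.factorial : ℂ)⁻¹) • ((LieAlgebra.ad A M ν) ^ k) x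

/-- The group of automorphisms generated by the `exp (ad ν)`, for those `ν ∈ S` for which `ad ν` is
nilpotent.
* If `S = 𝔫 ⊗ A`, where `𝔫` is the nilpotent radical of a Borel subalgebra of a complex simple
  Lie algebra, this is the group `N(A)` of `A`-points of the unipotent group of `𝔫`.
* If `S` is all of `𝔤 ⊗ A`, where `A = ℂ` or `A = ℂ[t]/tⁿ`, this is the group `G(A)` of `A`-points
  of the adjoint group `G` of `𝔤`. -/
def expGroup (S : Set M) : Subgroup (M ≃ₗ[A] M) :=
  Subgroup.closure {s | ∃ ν ∈ S, IsExpAd A ν s}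

end Groups

/-! ### Laurent series -/

/-- The field `ℂ((t))`. It is a copy of `LaurentSeries ℂ` with a single structure of an algebra
over `ℂ`, the coefficientwise one. -/
def Laurent : Type := LaurentSeries ℂ

instance : Field Laurent := inferInstanceAs (Field (LaurentSeries ℂ))

instance : Algebra ℂ Laurent :=
  (HahnSeries.instAlgebra : Algebra ℂ (HahnSeries ℤ ℂ))

/-- The derivative `d/dt`. -/
def Laurent.ddt : Laurent →ₗ[ℂ] Laurent :=
  (LaurentSeries.derivative ℂ : LaurentSeries ℂ →ₗ[ℂ] LaurentSeries ℂ)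

/-- The inclusion `ℂ[[t]] ⊆ ℂ((t))`. -/
def Laurent.ofPowerSeries : PowerSeries ℂ →ₐ[ℂ] Laurent :=
  { (HahnSeries.ofPowerSeries ℤ ℂ : PowerSeries ℂ →+* LaurentSeries ℂ) with
    commutes' := fun r => (HahnSeries.ofPowerSeries_C (Γ := ℤ) r) }

/-! ### Operators `∂_t + a(t)` on the punctured disk -/

section Operators

variable {L : Type*} [LieRing L] [LieAlgebra ℂ L]

/-- The operator `∂_t + a(t)`, `a(t) ∈ L((t))`, acting on `L((t))` by the adjoint representation
(which is faithful for semisimple `L`). -/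
def conn (a m : Laurent ⊗[ℂ] L) : Laurent ⊗[ℂ] L :=
  LinearMap.rTensor L Laurent.ddt m
    + ⁅a, m⁆

/-- `s ∘ (∂_t + a) ∘ s⁻¹ = ∂_t + a'`. -/
def IsGauge (s : (Laurent ⊗[ℂ] L) ≃ₗ[Laurent] (Laurent ⊗[ℂ] L))
    (a a' : Laurent ⊗[ℂ] L) : Prop :=
  ∀ m, s (conn a (s.symm m)) = conn a' m

lemma gauge_equivalence {X : Type*} (v : X → Laurent ⊗[ℂ] L)
    (G : Subgroup ((Laurent ⊗[ℂ] L) ≃ₗ[Laurent] (Laurent ⊗[ℂ] L))) :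
    Equivalence fun x y : X => ∃ s ∈ G, IsGauge s (v x) (v y) where
  refl x := ⟨1, G.one_mem, fun _ => rfl⟩
  symm := by
    rintro x y ⟨s, hs, h⟩
    refine ⟨s⁻¹, G.inv_mem hs, fun m => ?_⟩
    change s.symm (conn (v y) (s m)) = conn (v x) m
    rw [← h (s m)]
    simp
  trans := by
    rintro x y z ⟨s, hs, h⟩ ⟨s', hs', h'⟩
    refine ⟨s' * s, G.mul_mem hs' hs, fun m => ?_⟩
    change s' (s (conn (v x) (s.symm (s'.symm m)))) = conn (v z) m
    rw [h, h']

/-- The monomial `t ^ k`, `k ∈ ℤ`. -/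
def tPow (k : ℤ) : Laurent := (HahnSeries.single k 1 : LaurentSeries ℂ)

/-- The inclusion `L[[t]] ⊆ L((t))`. -/
def toLaurent (L : Type*) [AddCommGroup L] [Module ℂ L] :
    PowerSeries ℂ ⊗[ℂ] L →ₗ[ℂ] Laurent ⊗[ℂ] L :=
  LinearMap.rTensor L Laurent.ofPowerSeries.toLinearMap

/-- The ring `ℂ[t]/tⁿ`, as the quotient of `ℂ[[t]]`. -/
abbrev Jet (n : ℕ) : Type := PowerSeries ℂ ⧸ Ideal.span {(PowerSeries.X : PowerSeries ℂ) ^ n}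

/-- The class of the coordinate `t` in `ℂ[t]/tⁿ`. -/
def jetT (n : ℕ) : Jet n := Ideal.Quotient.mk _ PowerSeries.X

/-- The truncation `ev_n : V[[t]] → V_n`, `∑ x_i tⁱ ↦ ∑_{i < n} x_i tⁱ`. -/
def ev (n : ℕ) (V : Type*) [AddCommGroup V] [Module ℂ V] :
    PowerSeries ℂ ⊗[ℂ] V →ₗ[ℂ] Jet n ⊗[ℂ] V :=
  LinearMap.rTensor V
    (Ideal.Quotient.mkₐ ℂ (Ideal.span {(PowerSeries.X : PowerSeries ℂ) ^ n})).toLinearMap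

/-- Equality of the `N((t))`-conjugacy classes of `∂_t + p + x(t)` and `∂_t + p + y(t)`, with
`x(t), y(t) ∈ 𝔟((t))`. -/
def operSetoid (B N : Submodule ℂ L) (p : L) :
    Setoid (B.baseChange (Laurent)) where
  r x y := ∃ s ∈ expGroup (Laurent)
      (N.baseChange (Laurent) : Set (Laurent ⊗[ℂ] L)),
    IsGauge s (1 ⊗ₜ p + x.1) (1 ⊗ₜ p + y.1)
  iseqv := gauge_equivalence
    (fun x : B.baseChange (Laurent) => 1 ⊗ₜ p + x.1) _

/-- The operator part `t⁻ⁿ (p + x(t))`, with `x(t) ∈ L[[t]]`. -/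
def singPart (n : ℕ) (p : L) (x : PowerSeries ℂ ⊗[ℂ] L) : Laurent ⊗[ℂ] L :=
  tPow (-n) • (1 ⊗ₜ p + toLaurent L x)

/-- Equality of the `N[[t]]`-conjugacy classes of `∂_t + t⁻ⁿ (p + x(t))` and
`∂_t + t⁻ⁿ (p + y(t))`, with `x(t), y(t) ∈ 𝔟[[t]]`. -/
def operOrdSetoid (n : ℕ) (B N : Submodule ℂ L) (p : L) :
    Setoid (B.baseChange (PowerSeries ℂ)) where
  r x y := ∃ s ∈ expGroup (Laurent)
      (toLaurent L '' (N.baseChange (PowerSeries ℂ) : Set (PowerSeries ℂ ⊗[ℂ] L))),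
    IsGauge s (singPart n p x.1) (singPart n p y.1)
  iseqv := gauge_equivalence
    (fun x : B.baseChange (PowerSeries ℂ) => singPart n p x.1) _

/-- `σ` is the action of `ρ(t ^ m)` on `L((t))`, where the cocharacter `ρ` of the adjoint torus is
given by its derivative `ρ ∈ L`: it acts by `t ^ (m k)` on the `k`-eigenspace of `ad ρ`. -/
def IsRhoAction (ρ : L) (m : ℤ)
    (σ : (Laurent ⊗[ℂ] L) ≃ₗ[Laurent] (Laurent ⊗[ℂ] L)) : Prop :=
  ∀ (k : ℤ) (x : L), ⁅ρ, x⁆ = (k : ℂ) • x →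
    ∀ c : Laurent, σ (c ⊗ₜ x) = (tPow (m * k) * c) ⊗ₜ x

end Operators

/-! ### Polynomial functions and their invariants -/

section Invariants

/-- The algebra `ℂ[V]` of polynomial functions on a finite-dimensional vector space. -/
abbrev PolyFun (V : Type*) [AddCommGroup V] [Module ℂ V] : Type _ :=
  SymmetricAlgebra ℂ (Module.Dual ℂ V)

variable {V V' : Type*} [AddCommGroup V] [Module ℂ V] [AddCommGroup V'] [Module ℂ V']

/-- The pull-back of polynomial functions along a linear map. -/
def PolyFun.pullback (φ : V →ₗ[ℂ] V') : PolyFun V' →ₐ[ℂ] PolyFun V :=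
  SymmetricAlgebra.lift (SymmetricAlgebra.ι ℂ (Module.Dual ℂ V) ∘ₗ φ.dualMap)

/-- The value of a polynomial function at a point of `V`. -/
def PolyFun.eval (v : V) : PolyFun V →ₐ[ℂ] ℂ :=
  SymmetricAlgebra.lift (Module.Dual.eval ℂ V v)

/-- The value in `A` of a polynomial function on `V` at a point of `V ⊗ A`. -/
def PolyFun.evalAt {A : Type*} [CommRing A] [Algebra ℂ A] (v : A ⊗[ℂ] V) : PolyFun V →ₐ[ℂ] A :=
  SymmetricAlgebra.lift ((TensorProduct.rid ℂ A).toLinearMap ∘ₗ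
    LinearMap.applyₗ v ∘ₗ LinearMap.lTensorHom (R := ℂ) A)

/-- The subalgebra of `ℂ[V]` of polynomial functions invariant under a set of linear maps. -/
def PolyFun.invariants (G : Set (V →ₗ[ℂ] V)) : Subalgebra ℂ (PolyFun V) :=
  ⨅ g ∈ G, AlgHom.equalizer (PolyFun.pullback g) (AlgHom.id ℂ (PolyFun V))

variable (L : Type*) [LieRing L] [LieAlgebra ℂ L]

/-- `ℂ[L]^G`, where `G` is the adjoint group of `L`. -/
def adjointInvariants : Subalgebra ℂ (PolyFun L) :=
  PolyFun.invariants {g | ∃ s ∈ expGroup ℂ (Set.univ : Set L), g = s.toLinearMap}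

/-- `ℂ[L_n]^{G_n}`, where `L_n = L[t]/tⁿ` and `G_n = G(ℂ[t]/tⁿ)`. -/
def jetAdjointInvariants (n : ℕ) : Subalgebra ℂ (PolyFun (Jet n ⊗[ℂ] L)) :=
  PolyFun.invariants {g | ∃ s ∈ expGroup (Jet n) (Set.univ : Set (Jet n ⊗[ℂ] L)),
    g = s.toLinearMap.restrictScalars ℂ}

/-- The (points of the) adjoint quotient `L_n / G_n = Spec ℂ[L_n]^{G_n}`. -/
abbrev JetAdjointQuotient (n : ℕ) : Type _ := jetAdjointInvariants L n →ₐ[ℂ] ℂ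

variable {L}

/-- The projection `L_n → L_n / G_n`. -/
def toJetAdjointQuotient (n : ℕ) (x : Jet n ⊗[ℂ] L) : JetAdjointQuotient L n :=
  (PolyFun.eval x).comp (jetAdjointInvariants L n).val

end Invariants

/-! ### The Langlands dual Lie algebra -/

open LieAlgebra LieAlgebra.IsKilling

section Dual

variable {g : Type*} [LieRing g] [LieAlgebra ℂ g] [FiniteDimensional ℂ g] [IsKilling ℂ g]
  (H : LieSubalgebra ℂ g) [H.IsCartanSubalgebra]
  {g' : Type*} [LieRing g'] [LieAlgebra ℂ g'] [FiniteDimensional ℂ g'] [IsKilling ℂ g']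
  (H' : LieSubalgebra ℂ g') [H'.IsCartanSubalgebra]

/-- The data exhibiting `(g', H')` as Langlands dual to `(g, H)`: an isomorphism of the root system
of `(g', H')` with the dual of the root system of `(g, H)`. -/
abbrev LanglandsDual : Type _ :=
  RootPairing.Equiv (rootSystem H') (rootSystem H).flip

variable {H H'}
variable (b : (rootSystem H).Base) (e : LanglandsDual H H')

/-- The identification of `𝔥* = Hom(𝔥, ℂ)` with the Cartan subalgebra `H'` of the dual Lie algebra;
it takes roots of `g` to coroots of `g'`. -/
def dualCartan : Module.Dual ℂ H →ₗ[ℂ] g' :=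
  H'.toSubmodule.subtype ∘ₗ (RootPairing.Equiv.coweightEquiv _ _ e).toLinearMap

/-- The same identification with coefficients in `A`. -/
def dualCartanOver (A : Type*) [CommRing A] [Algebra ℂ A] :
    A ⊗[ℂ] Module.Dual ℂ H →ₗ[ℂ] A ⊗[ℂ] g' :=
  LinearMap.lTensor A (dualCartan e)

/-- The nilpotent radical `𝔫` of the Borel subalgebra of `g'`: the sum of the root spaces of
the roots of `g'` that are dual to positive roots of `g`. -/
def dualNil : Submodule ℂ g' :=
  ⨆ α : {α : H'.root // b.IsPos (e.indexEquiv α)}, (rootSpace H' (α.1.1 : H' → ℂ)).toSubmodule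

/-- The Borel subalgebra `𝔟 = 𝔥 ⊕ 𝔫` of `g'`. -/
def dualBorel : Submodule ℂ g' := H'.toSubmodule ⊔ dualNil b e

/-- `f` consists of generators of the root spaces of the negative simple roots of `g'`. -/
def IsNegSimpleGenerators (f : b.support → g') : Prop :=
  ∀ i : b.support, f i ≠ 0 ∧
    f i ∈ rootSpace H' (-((e.indexEquiv.symm i.1).1 : H' → ℂ))

/-- `ρ ∈ 𝔥*`, half the sum of the positive roots of `g`. -/
def rho : Module.Dual ℂ H :=
  open scoped Classical in
  (1 / 2 : ℂ) • ∑ α : H.root with b.IsPos α, (rootSystem H).root α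

/-- `ρ_n = n ρ tⁿ⁻¹`; paired with `h = ∑ h_i tⁱ` by `Res_{t=0} ⟨·, h⟩ dt / tⁿ`, this is the
functional `h ↦ n ρ(h_0)` on `𝔥_n`. -/
def rhoJet (n : ℕ) : Jet n ⊗[ℂ] Module.Dual ℂ H :=
  (jetT n ^ (n - 1)) ⊗ₜ[ℂ] ((n : ℂ) • rho b)

variable (H) in
/-- `ℂ[𝔥*]^W`; the Weyl group `W` is generated by the reflections in the roots. -/
def weylInvariants : Subalgebra ℂ (PolyFun (Module.Dual ℂ H)) :=
  PolyFun.invariants {g | ∃ α : H.root, g = ((rootSystem H).reflection α).toLinearMap}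

variable (H) in
/-- The (points of the) jet scheme `(𝔥*/W)_n`, where `𝔥*/W = Spec ℂ[𝔥*]^W`. -/
abbrev WeylQuotientJet (n : ℕ) : Type _ := weylInvariants H →ₐ[ℂ] Jet n

/-- The canonical map `ϖ : 𝔥*_n → (𝔥*/W)_n`. -/
def varpi (n : ℕ) (Λ : Jet n ⊗[ℂ] Module.Dual ℂ H) : WeylQuotientJet H n :=
  (PolyFun.evalAt Λ).comp (weylInvariants H).val

/-- The graph of the canonical isomorphism `g'_n / G'_n ≃ (𝔥*/W)_n`.

The isomorphism is dual to `ℂ[(𝔥*/W)_n] ≃ ℂ[(g'/G')_n] ≃ ℂ[g'_n]^{G'_n}`. The first map is the one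
induced on jets by the restriction `ℂ[g']^{G'} ≃ ℂ[𝔥*]^W`, `P ↦ Q`, and the second takes the `k`-th
coordinate function of `P` to the coefficient `F_k` of `tᵏ` in `x ↦ P(x)`, `x ∈ g'_n`. -/
def CanonicallyIdentified (n : ℕ) (χ : JetAdjointQuotient g' n) (ψ : WeylQuotientJet H n) : Prop :=
  ∀ P ∈ adjointInvariants g',
    ∃ (Q : weylInvariants H) (F : Fin n → jetAdjointInvariants g' n),
      (Q : PolyFun (Module.Dual ℂ H)) = PolyFun.pullback (dualCartan e) P ∧
      (∀ x : Jet n ⊗[ℂ] g',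
        PolyFun.evalAt x P = ∑ k, PolyFun.eval x (F k : PolyFun (Jet n ⊗[ℂ] g')) • jetT n ^ (k : ℕ)) ∧
      ψ Q = ∑ k, χ (F k) • jetT n ^ (k : ℕ)

/-! ### Opers, their residues, and the Miura transformation -/

variable (f : b.support → g')

/-- `p₋₁`, the sum of the generators for the negative simple roots. -/
def pMinusOne : g' := ∑ i, f i

/-- Opers on the punctured disk. -/
abbrev Oper : Type _ := Quotient (operSetoid (dualBorel b e) (dualNil b e) (pMinusOne b f))

/-- Opers on the disk with singularity of order at most `n`. -/
abbrev OperOrd (n : ℕ) : Type _ :=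
  Quotient (operOrdSetoid n (dualBorel b e) (dualNil b e) (pMinusOne b f))

/-- The graph of the map from opers with singularity of order at most `n` to opers on the punctured
disk: conjugation by `ρ(t)ⁿ` takes the operator `∂_t + p₋₁ + y(t)` to
`∂_t + t⁻ⁿ (p₋₁ + x(t))`. -/
def OperOrd.MapsTo (n : ℕ) (O : OperOrd b e f n) (o : Oper b e f) : Prop :=
  ∃ (x : (dualBorel b e).baseChange (PowerSeries ℂ))
    (y : (dualBorel b e).baseChange (Laurent))
    (σ : (Laurent ⊗[ℂ] g') ≃ₗ[Laurent] (Laurent ⊗[ℂ] g')),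
    (Quotient.mk _ x : OperOrd b e f n) = O ∧ (Quotient.mk _ y : Oper b e f) = o ∧
      IsRhoAction (dualCartan e (rho b)) n σ ∧
      IsGauge σ (1 ⊗ₜ pMinusOne b f + y.1) (singPart n (pMinusOne b f) x.1)

/-- `χ` is the `n`-th residue of `O` in `g'_n / G'_n`: for every operator
`∂_t + t⁻ⁿ (p₋₁ + x(t))` in the class `O`, it is the image of `p₋₁ + ev_n(x(t))`. -/
def OperOrd.IsResidue (n : ℕ) (O : OperOrd b e f n) (χ : JetAdjointQuotient g' n) : Prop :=
  ∀ x : (dualBorel b e).baseChange (PowerSeries ℂ), (Quotient.mk _ x : OperOrd b e f n) = O →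
    toJetAdjointQuotient n (1 ⊗ₜ pMinusOne b f + ev n g' x.1) = χ

lemma dualCartanOver_mem (A : Type*) [CommRing A] [Algebra ℂ A] (u : A ⊗[ℂ] Module.Dual ℂ H) :
    dualCartanOver e A u ∈ (dualBorel b e).baseChange A := by
  induction u with
  | zero => simp
  | add x y hx hy => rw [map_add]; exact add_mem hx hy
  | tmul a x =>
    refine Submodule.tmul_mem_baseChange_of_mem a ?_
    exact Submodule.mem_sup_left (RootPairing.Equiv.coweightEquiv _ _ e x).2

/-- The Miura transformation: the connection `∂_t + v(t)`, `v(t) ∈ 𝔥*((t))`, is taken to the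
class of `∂_t + p₋₁ + v(t)`. -/
def miura (v : Laurent ⊗[ℂ] Module.Dual ℂ H) : Oper b e f :=
  Quotient.mk _ ⟨dualCartanOver e (Laurent) v, dualCartanOver_mem b e (Laurent) v⟩

/-- The connection `∂_t + t⁻ⁿ u(t)`, `u(t) ∈ 𝔥*[[t]]`, with a pole of order at most `n`. -/
def connOrd (n : ℕ) (u : PowerSeries ℂ ⊗[ℂ] Module.Dual ℂ H) :
    Laurent ⊗[ℂ] Module.Dual ℂ H :=
  tPow (-n) • toLaurent (Module.Dual ℂ H) u

end Dual

end IrregularOpers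

end

/-! The Miura oper of `∂_t + t⁻ⁿ u(t)` is `∂_t + p₋₁ + t⁻ⁿ u(t)`. Let `ρ' = dualCartan e (rho b)`.
As `[ρ', p₋₁] = -p₋₁`, conjugation by `ρ(t)ⁿ` multiplies `p₋₁` by `t⁻ⁿ`, fixes the Cartan part and
adds the logarithmic derivative `-n ρ' t⁻¹`, so it gives `∂_t + t⁻ⁿ (p₋₁ + u(t) - n ρ' tⁿ⁻¹)`
(`IsRhoAction.isGauge_singPart`). This is an oper with singularity of order at most `n`. Its residue
is the image of `p₋₁ + z`, where `z = Res(u) - ρ_n` commutes with `ρ'`; the torus generated by `ρ'`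
contracts `p₋₁ + z` to `z`, so it is the image of `z` (`toJetAdjointQuotient_add_eq`).

The residue has to be the same for every representative of every oper with singularity that is
mapped to the Miura oper. Two such representatives are conjugate under a unipotent automorphism with
coefficients in `ℂ((t))`, with no a priori regularity, so the content is that such a gauge
transformation preserves the residue (`AdGrading.toJetAdjointQuotient_eq_of_isGauge`). Grade `𝔤'` by
the eigenvalues of `ad ρ'`. If the gauge transformation is the identity up to terms raising degrees
by at least `k`, with leading term `ad ν`, then comparison of the operators in degree `k - 1` shows
that `[ν, p₋₁]` is regular. Since `ad p₋₁` is injective in positive degrees, by `𝔰𝔩₂`-theory for the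
principal triple `(2ρ', ∑ c_i e_i, p₋₁)` (`eq_zero_of_lie_pMinusOne_eq_zero`), `ν` itself is
regular. Then `exp (ad ν)` is a regular gauge transformation; modulo `tⁿ` it acts on `t⁻ⁿ (p₋₁ + x)`
by the adjoint action alone, so it preserves the residue, and it can be divided off. Induction on
`k` ends because the grading is finite. No statement about algebraic groups is needed, only
automorphisms of `𝔤' ⊗ ℂ((t))` compatible with the grading.

The compatibility with `(𝔥*/W)_n` requires that the coefficients `F_k` of an invariant polynomial
`P`, evaluated on jets, are invariant under the adjoint group over `ℂ[t]/tⁿ`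
(`exists_jet_coefficients`). Invariance of `P` under exponentials of nilpotent elements gives
`D_{ad y} P = 0` first for `y` nilpotent and then for all `y`, as these generate `𝔤'`; since the derivative
of `s ↦ P(exp(s ad ν) x)` is an `A`-combination of the values of the `D_{ad y} P` along the curve,
the values of `P` on `A`-points are invariant for any `A`. That `P` restricts to a Weyl group
invariant follows from the formula `s_α = exp(ad e) exp(-ad f) exp(ad e)` on the Cartan subalgebra
(`exists_mem_expGroup_reflection`). -/

noncomputable section

namespace IrregularOpers

/-! ### Polynomial functions: evaluation, derivations, exponential curves -/

namespace PolyFun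

variable {V V' : Type*} [AddCommGroup V] [Module ℂ V] [AddCommGroup V'] [Module ℂ V']

/-- Algebra homomorphisms out of `ℂ[V]` are determined by their values on linear forms. -/
lemma algHom_apply_eq {B : Type*} [CommRing B] [Algebra ℂ B] {Φ Ψ : PolyFun V →ₐ[ℂ] B}
    (h : ∀ φ : Module.Dual ℂ V, Φ (SymmetricAlgebra.ι ℂ _ φ) = Ψ (SymmetricAlgebra.ι ℂ _ φ))
    (P : PolyFun V) : Φ P = Ψ P :=
  congr($(SymmetricAlgebra.algHom_ext (LinearMap.ext h)) P)

lemma evalAt_ι {A : Type*} [CommRing A] [Algebra ℂ A] (x : A ⊗[ℂ] V) (φ : Module.Dual ℂ V) :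
    evalAt x (SymmetricAlgebra.ι ℂ _ φ) = φ.baseChange A x := by
  rw [evalAt, SymmetricAlgebra.lift_ι_apply]
  induction x with
  | zero => simp
  | add x y hx hy => simp only [map_add, ← hx, ← hy]; simp
  | tmul a v => simp

@[simp]
lemma eval_ι (x : V) (φ : Module.Dual ℂ V) : eval x (SymmetricAlgebra.ι ℂ _ φ) = φ x := by
  simp [eval]

@[simp]
lemma pullback_ι (T : V →ₗ[ℂ] V') (φ : Module.Dual ℂ V') :
    pullback T (SymmetricAlgebra.ι ℂ _ φ) = SymmetricAlgebra.ι ℂ _ (φ ∘ₗ T) := by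
  simp [pullback, LinearMap.dualMap_apply']

lemma eval_pullback (T : V →ₗ[ℂ] V') (x : V) (P : PolyFun V') :
    eval x (pullback T P) = eval (T x) P := by
  refine algHom_apply_eq (Φ := (eval x).comp (pullback T)) (fun φ => ?_) P
  simp

lemma evalAt_pullback {A : Type*} [CommRing A] [Algebra ℂ A] (T : V →ₗ[ℂ] V') (x : A ⊗[ℂ] V)
    (P : PolyFun V') : evalAt x (pullback T P) = evalAt (LinearMap.lTensor A T x) P := by
  refine algHom_apply_eq (Φ := (evalAt x).comp (pullback T)) (fun φ => ?_) P
  rw [AlgHom.comp_apply, pullback_ι, evalAt_ι, evalAt_ι]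
  induction x with
  | zero => simp
  | add x y hx hy => simp only [map_add, ← hx, ← hy]
  | tmul a v => simp

/-- Over an infinite field a polynomial function is determined by its values. -/
lemma eq_of_forall_eval_eq [FiniteDimensional ℂ V] {P Q : PolyFun V}
    (h : ∀ x, eval x P = eval x Q) : P = Q := by
  let b := Module.finBasis ℂ V
  apply (SymmetricAlgebra.equivMvPolynomial b.dualBasis).injective
  apply MvPolynomial.funext
  intro x
  have key : ∀ R : PolyFun V, MvPolynomial.eval x (SymmetricAlgebra.equivMvPolynomial b.dualBasis R)
      = eval (∑ i, x i • b i) R := by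
    intro R
    rw [← MvPolynomial.coe_aeval_eq_eval]
    suffices (MvPolynomial.aeval x).comp (SymmetricAlgebra.equivMvPolynomial b.dualBasis).toAlgHom =
      eval (∑ i, x i • b i) from congr($this R)
    apply SymmetricAlgebra.algHom_ext
    apply b.dualBasis.ext
    intro i
    simp only [LinearMap.comp_apply]
    refine Eq.trans (congrArg (MvPolynomial.aeval x)
      (SymmetricAlgebra.equivMvPolynomial_ι_apply b.dualBasis i)) ?_
    simp [Finsupp.single_apply]
  rw [key, key, h]

lemma mem_invariants {G : Set (V →ₗ[ℂ] V)} {P : PolyFun V} :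
    P ∈ invariants G ↔ ∀ g ∈ G, pullback g P = P := by
  simp [invariants, Algebra.mem_iInf, AlgHom.mem_equalizer]

/-- The linear vector field `x ↦ T x` on `V`, as a derivation of `ℂ[V]`: it takes a linear form
`φ` to `φ ∘ T`. -/
def der (T : V →ₗ[ℂ] V) : Derivation ℂ (PolyFun V) (PolyFun V) :=
  -- the first order part of the deformation `φ ↦ φ + s φ ∘ T` of the identity
  let Ψ : PolyFun V →ₐ[ℂ] Polynomial (PolyFun V) := SymmetricAlgebra.lift
    ((Polynomial.monomial 0).restrictScalars ℂ ∘ₗ SymmetricAlgebra.ι ℂ (Module.Dual ℂ V) +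
      (Polynomial.monomial 1).restrictScalars ℂ ∘ₗ SymmetricAlgebra.ι ℂ (Module.Dual ℂ V) ∘ₗ
        T.dualMap)
  have h0 : ∀ P, (Ψ P).coeff 0 = P := by
    intro P
    rw [Polynomial.coeff_zero_eq_aeval_zero]
    exact algHom_apply_eq (Φ := ((Polynomial.aeval (R := PolyFun V) 0).restrictScalars ℂ).comp Ψ)
      (Ψ := AlgHom.id ℂ _) (fun φ => by simp [Ψ]) P
  Derivation.mk' ((Polynomial.lcoeff (PolyFun V) 1).restrictScalars ℂ ∘ₗ Ψ.toLinearMap) <| by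
    intro P Q
    simp [Polynomial.mul_coeff_one, h0]
    ring

@[simp]
lemma der_ι (T : V →ₗ[ℂ] V) (φ : Module.Dual ℂ V) :
    der T (SymmetricAlgebra.ι ℂ _ φ) = SymmetricAlgebra.ι ℂ _ (φ ∘ₗ T) := by
  simp [der, LinearMap.dualMap_apply']

/-- A combination of derivations `Φ ∘ D_T` along an algebra homomorphism `Φ` is determined by its
values on linear forms. -/
lemma derivation_comp_eq {B κ : Type*} [CommRing B] [Algebra ℂ B] (Φ : PolyFun V →ₐ[ℂ] B)
    (δ : Derivation ℂ B B) (s : Finset κ) (c : κ → B) (T : κ → V →ₗ[ℂ] V)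
    (h : ∀ φ : Module.Dual ℂ V, δ (Φ (SymmetricAlgebra.ι ℂ _ φ)) =
      ∑ i ∈ s, c i * Φ (SymmetricAlgebra.ι ℂ _ (φ ∘ₗ T i))) (P : PolyFun V) :
    δ (Φ P) = ∑ i ∈ s, c i * Φ (der (T i) P) := by
  induction P using SymmetricAlgebra.induction with
  | algebraMap r => simp
  | ι φ => simp [h]
  | add P Q hP hQ => simp [hP, hQ, mul_add, Finset.sum_add_distrib]
  | mul P Q hP hQ =>
    simp only [map_mul, Derivation.leibniz, hP, hQ, smul_eq_mul, map_add, mul_add,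
      Finset.sum_add_distrib, Finset.mul_sum]
    congr 1 <;> exact Finset.sum_congr rfl fun i _ => by ring

lemma der_eq_sum {κ : Type*} (s : Finset κ) (c : κ → ℂ) (T : κ → V →ₗ[ℂ] V) (P : PolyFun V) :
    der (∑ i ∈ s, c i • T i) P = ∑ i ∈ s, c i • der (T i) P := by
  have := derivation_comp_eq (AlgHom.id ℂ (PolyFun V)) (der (∑ i ∈ s, c i • T i)) s
    (fun i => algebraMap ℂ _ (c i)) T (fun φ => by
      have : φ ∘ₗ (∑ i ∈ s, c i • T i) = ∑ i ∈ s, c i • φ ∘ₗ T i := by ext; simp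
      rw [AlgHom.id_apply, der_ι, this, map_sum]
      exact Finset.sum_congr rfl fun i _ => by rw [map_smul, Algebra.smul_def, AlgHom.id_apply]) P
  simpa [Algebra.smul_def] using this

lemma der_comp_sub_comp (T T' : V →ₗ[ℂ] V) (P : PolyFun V) :
    der (T ∘ₗ T' - T' ∘ₗ T) P = der T' (der T P) - der T (der T' P) := by
  have := derivation_comp_eq (AlgHom.id ℂ (PolyFun V)) ⁅der T', der T⁆ {()} 1
    (fun _ => T ∘ₗ T' - T' ∘ₗ T) (fun φ => by
      simp [Derivation.commutator_apply, LinearMap.comp_sub, LinearMap.comp_assoc]) P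
  simpa [Derivation.commutator_apply] using this.symm

/-- The endomorphisms whose vector field annihilates `P` form a linear subspace, which
`der_comp_sub_comp` shows to be closed under commutators. -/
def annihilator (P : PolyFun V) : Submodule ℂ (V →ₗ[ℂ] V) where
  carrier := {T | der T P = 0}
  zero_mem' := by simpa using der_eq_sum (V := V) (κ := Unit) ∅ 0 0 P
  add_mem' {T T'} h h' := by
    have := der_eq_sum Finset.univ 1 ![T, T'] P
    simp only [Fin.sum_univ_two] at this
    simp_all
  smul_mem' c T h := by
    have := der_eq_sum {()} (fun _ => c) (fun _ => T) P
    simp_all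

section Curve

variable {A : Type*} [CommRing A] [Algebra ℂ A] {W : Type*} [AddCommGroup W] [Module A W]

/-- The polynomial `∑ ψ(Nᵏ x) sᵏ / k!` in `s`, whose value at `s` is `ψ (exp (s N) x)` if
`N ^ m = 0`. -/
def expCurve (N : Module.End A W) (m : ℕ) (x : W) : (W →ₗ[A] A) →ₗ[ℂ] Polynomial A where
  toFun ψ := ∑ k ∈ Finset.range m, Polynomial.monomial k (((k.factorial : ℂ)⁻¹) • ψ ((N ^ k) x))
  map_add' ψ ψ' := by simp [Finset.sum_add_distrib]
  map_smul' c ψ := by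
    simp only [LinearMap.smul_apply, RingHom.id_apply, Finset.smul_sum, Polynomial.smul_monomial]
    exact Finset.sum_congr rfl fun k _ => by rw [smul_comm]

lemma derivative_expCurve {N : Module.End A W} {m : ℕ} (hN : N ^ m = 0) (x : W) (ψ : W →ₗ[A] A) :
    Polynomial.derivative (expCurve N m x ψ) = expCurve N m x (ψ ∘ₗ N) := by
  cases m with
  | zero => simp [expCurve]
  | succ m =>
    have hN' : N ((N ^ m) x) = 0 := by rw [← Module.End.mul_apply, ← pow_succ', hN]; rfl
    simp only [expCurve, LinearMap.coe_mk, AddHom.coe_mk, Polynomial.derivative_sum,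
      Polynomial.derivative_monomial]
    rw [Finset.sum_range_succ', Finset.sum_range_succ]
    simp only [LinearMap.comp_apply, hN', map_zero, smul_zero, add_zero, Nat.cast_zero, mul_zero]
    refine Finset.sum_congr rfl fun k _ => ?_
    simp only [Nat.add_sub_cancel, pow_succ', Module.End.mul_apply]
    congr 1
    rw [smul_mul_assoc, mul_comm, ← nsmul_eq_mul, ← Nat.cast_smul_eq_nsmul ℂ, smul_smul]
    congr 1
    have : (k.factorial : ℂ) ≠ 0 := by exact_mod_cast k.factorial_ne_zero
    rw [Nat.factorial_succ]
    push_cast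
    field_simp

lemma eval_expCurve (N : Module.End A W) (m : ℕ) (x : W) (ψ : W →ₗ[A] A) (s : A) :
    (expCurve N m x ψ).eval s =
      ∑ k ∈ Finset.range m, ((k.factorial : ℂ)⁻¹) • (ψ ((N ^ k) x) * s ^ k) := by
  simp [expCurve, Polynomial.eval_finsetSum]

end Curve

/-- A polynomial function that is invariant under the one-parameter group `exp (s T)`, where `T` is
nilpotent, is annihilated by the vector field of `T`. -/
lemma der_eq_zero_of_forall_exp [FiniteDimensional ℂ V] {T : Module.End ℂ V} {m : ℕ}
    (hT : T ^ m = 0) {P : PolyFun V}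
    (hP : ∀ (s : ℂ) (x : V),
      eval (∑ k ∈ Finset.range m, ((k.factorial : ℂ)⁻¹) • ((s • T) ^ k) x) P = eval x P) :
    der T P = 0 := by
  apply eq_of_forall_eval_eq
  intro x
  let Φ : PolyFun V →ₐ[ℂ] Polynomial ℂ := SymmetricAlgebra.lift (expCurve T m x)
  have hΦ : ∀ (s : ℂ) (R : PolyFun V), (Φ R).eval s =
      eval (∑ k ∈ Finset.range m, ((k.factorial : ℂ)⁻¹) • ((s • T) ^ k) x) R := by
    intro s R
    rw [← Polynomial.coe_aeval_eq_eval]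
    refine algHom_apply_eq (Φ := (Polynomial.aeval s).comp Φ) (fun φ => ?_) R
    rw [AlgHom.comp_apply, SymmetricAlgebra.lift_ι_apply, eval_ι, Polynomial.coe_aeval_eq_eval,
      eval_expCurve, map_sum]
    exact Finset.sum_congr rfl fun k _ => by simp [smul_pow, mul_comm]
  have hconst : Φ P = Polynomial.C (eval x P) :=
    Polynomial.funext fun s => by rw [hΦ, hP, Polynomial.eval_C]
  have hder : Polynomial.derivative (Φ P) = Φ (der T P) := by
    have := derivation_comp_eq Φ (Polynomial.derivative' (R := ℂ)) {()} 1 (fun _ => T) (fun φ => by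
      simp only [Φ, SymmetricAlgebra.lift_ι_apply, Finset.sum_singleton, Pi.one_apply, one_mul]
      exact derivative_expCurve hT x φ) P
    simpa using this
  have h0 := hΦ 0 (der T P)
  rw [← hder, hconst, Polynomial.derivative_C, Polynomial.eval_zero] at h0
  rw [map_zero, h0]
  cases m with
  | zero =>
    have : Subsingleton (Module.End ℂ V) := subsingleton_of_zero_eq_one (by simpa using hT.symm)
    have : x = 0 := by simpa using congr($(Subsingleton.elim (1 : Module.End ℂ V) 0) x)
    simp [this]
  | succ m =>
    rw [Finset.sum_range_succ']
    simp

/-- If `P` is annihilated by the vector fields of all the `T i`, then its values on `A`-points are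
invariant under `exp N` for nilpotent `N = ∑ c_i ⊗ T_i`. -/
lemma evalAt_exp_eq {A κ : Type*} [CommRing A] [Algebra ℂ A] (s : Finset κ) (c : κ → A)
    (T : κ → V →ₗ[ℂ] V) {P : PolyFun V} (hP : ∀ i ∈ s, der (T i) P = 0)
    {N : Module.End A (A ⊗[ℂ] V)} (hN : ∀ z, N z = ∑ i ∈ s, c i • (T i).baseChange A z)
    {m : ℕ} (hm : N ^ m = 0) (x : A ⊗[ℂ] V) :
    evalAt (∑ k ∈ Finset.range m, ((k.factorial : ℂ)⁻¹) • (N ^ k) x) P = evalAt x P := by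
  let Φ : PolyFun V →ₐ[ℂ] Polynomial A :=
    SymmetricAlgebra.lift (expCurve N m x ∘ₗ Module.Dual.baseChange A)
  have hΦ : ∀ (r : A) (y : A ⊗[ℂ] V),
      (∀ φ : Module.Dual ℂ V, (expCurve N m x (φ.baseChange A)).eval r = φ.baseChange A y) →
        (Φ P).eval r = evalAt y P := by
    intro r y h
    rw [← Polynomial.coe_aeval_eq_eval]
    refine algHom_apply_eq (Φ := ((Polynomial.aeval r).restrictScalars ℂ).comp Φ) (fun φ => ?_) P
    rw [AlgHom.comp_apply, SymmetricAlgebra.lift_ι_apply, evalAt_ι, AlgHom.restrictScalars_apply,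
      Polynomial.coe_aeval_eq_eval]
    exact h φ
  have hder : Polynomial.derivative (Φ P) = 0 := by
    have := derivation_comp_eq Φ ((Polynomial.derivative' (R := A)).restrictScalars ℂ) s
      (fun i => Polynomial.C (c i)) T (fun φ => by
      simp only [Φ, SymmetricAlgebra.lift_ι_apply, LinearMap.comp_apply]
      refine (derivative_expCurve hm x (φ.baseChange A)).trans ?_
      have h : φ.baseChange A ∘ₗ N = ∑ i ∈ s, c i • Module.Dual.baseChange A (φ ∘ₗ T i) := by
        ext v
        simp [hN]
      rw [h]
      simp only [expCurve, LinearMap.coe_mk, AddHom.coe_mk, LinearMap.smul_apply,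
        Finset.mul_sum, Polynomial.C_mul_monomial, map_sum, smul_eq_mul, mul_smul_comm]) P
    refine Eq.trans (by simp) (this.trans (Finset.sum_eq_zero fun i hi => ?_))
    rw [hP i hi, map_zero, mul_zero]
  have hC : Φ P = Polynomial.C ((Φ P).coeff 0) := by
    have : Module ℚ A := Module.compHom A (algebraMap ℚ ℂ)
    have : IsAddTorsionFree A := IsAddTorsionFree.of_module_rat A
    exact Polynomial.eq_C_of_derivative_eq_zero hder
  have h1 := hΦ 1 (∑ k ∈ Finset.range m, ((k.factorial : ℂ)⁻¹) • (N ^ k) x) (fun φ => by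
    rw [eval_expCurve, map_sum]
    refine Finset.sum_congr rfl fun k _ => ?_
    rw [one_pow, mul_one]
    exact ((φ.baseChange A).map_smul_of_tower _ _).symm)
  have h0 := hΦ 0 x (fun φ => by
    rw [eval_expCurve]
    cases m with
    | zero =>
      have h1 : (1 : Module.End A (A ⊗[ℂ] V)) = 0 := by simpa using hm
      have : x = 0 := by simpa using congr($h1 x)
      simp [this]
    | succ m =>
      rw [Finset.sum_range_succ']
      simp)
  rw [← h1, ← h0, hC, Polynomial.eval_C, Polynomial.eval_C]

/-- If `T` acts by `-1` on `p` and kills `h`, the flow of `T` contracts `h + p` to `h`; so these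
points are not separated by the polynomial functions that the vector field of `T` annihilates. -/
lemma eval_add_eq_of_der_eq_zero {T : V →ₗ[ℂ] V} {P : PolyFun V} (hP : der T P = 0) {h p : V}
    (hh : T h = 0) (hp : T p = -p) : eval (p + h) P = eval h P := by
  let Φ : PolyFun V →ₐ[ℂ] Polynomial ℂ := SymmetricAlgebra.lift
    (Polynomial.monomial 0 ∘ₗ Module.Dual.eval ℂ V h + Polynomial.monomial 1 ∘ₗ
      Module.Dual.eval ℂ V p)
  have hΦ : ∀ r : ℂ, (Φ P).eval r = eval (r • p + h) P := by
    intro r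
    rw [← Polynomial.coe_aeval_eq_eval]
    refine algHom_apply_eq (Φ := (Polynomial.aeval r).comp Φ) (fun φ => ?_) P
    simp [Φ]
    ring
  have hder := derivation_comp_eq Φ
    ((Polynomial.X : Polynomial ℂ) • Polynomial.derivative' (R := ℂ)) {()}
    (fun _ => -1) (fun _ => T) (fun φ => by
      simp [Φ, hh, hp, ← Polynomial.C_mul_X_pow_eq_monomial]) P
  have h0 : Polynomial.derivative (Φ P) = 0 := by
    simpa [hP] using hder
  have hC : Φ P = Polynomial.C ((Φ P).coeff 0) := Polynomial.eq_C_of_derivative_eq_zero h0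
  have h1 := hΦ 1
  have h2 := hΦ 0
  rw [hC, Polynomial.eval_C] at h1 h2
  simpa using h1.symm.trans h2

end PolyFun

/-! ### Exponentials of nilpotent inner derivations -/

section ExpAd

variable {A : Type*} [CommRing A] {M : Type*} [LieRing M] [LieAlgebra A M]
  [Module ℂ M]

lemma sum_range_eq_of_pow_eq_zero {N : Module.End A M} {m m' : ℕ} (h : N ^ m = 0)
    (h' : N ^ m' = 0) (c : ℕ → ℂ) (x : M) :
    ∑ k ∈ Finset.range m, c k • (N ^ k) x = ∑ k ∈ Finset.range m', c k • (N ^ k) x := by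
  wlog hle : m ≤ m' generalizing m m'
  · exact (this h' h (by lia)).symm
  refine Finset.sum_subset (by simpa using hle) fun k _ hk => ?_
  rw [pow_eq_zero_of_le (by simpa using hk) h, LinearMap.zero_apply, smul_zero]

lemma IsExpAd.apply_eq {ν : M} {s : M ≃ₗ[A] M} (hs : IsExpAd A ν s) {m : ℕ}
    (hm : (LieAlgebra.ad A M ν) ^ m = 0) (x : M) :
    s x = ∑ k ∈ Finset.range m, ((k.factorial : ℂ)⁻¹) • ((LieAlgebra.ad A M ν) ^ k) x := by
  obtain ⟨m', hm', h⟩ := hs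
  rw [h, sum_range_eq_of_pow_eq_zero hm' hm]

variable [Algebra ℂ A] [IsScalarTower ℂ A M]

lemma exists_lieEquiv_isExpAd {ν : M} {m : ℕ} (hm : (LieAlgebra.ad A M ν) ^ m = 0) :
    ∃ s : M ≃ₗ⁅A⁆ M, IsExpAd A ν s.toLinearEquiv := by
  let _ : Module ℚ M := Module.compHom M (algebraMap ℚ ℂ)
  let _ : LieAlgebra ℚ M :=
    { lie_smul := fun q x y => by
        change ⁅x, ((q : ℂ)) • y⁆ = (q : ℂ) • ⁅x, y⁆
        rw [← algebraMap_smul A, lie_smul, algebraMap_smul] }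
  have had : (LieDerivation.ad A M ν).toLinearMap = LieAlgebra.ad A M ν := by ext; simp
  rw [← had] at hm
  have hnil : IsNilpotent (LieDerivation.ad A M ν).toLinearMap := ⟨m, hm⟩
  refine ⟨LieDerivation.exp (LieDerivation.ad A M ν) hnil, m, had ▸ hm, fun x => ?_⟩
  change LieDerivation.exp (LieDerivation.ad A M ν) hnil x = _
  rw [LieDerivation.exp_map_apply,
    IsNilpotent.exp_eq_sum hm, LinearMap.sum_apply, had]
  refine Finset.sum_congr rfl fun k _ => ?_
  change (((k.factorial : ℚ)⁻¹ : ℚ) : ℂ) • ((LieAlgebra.ad A M ν) ^ k) x = _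
  push_cast
  rfl

lemma exists_isExpAd {ν : M} {m : ℕ} (hm : (LieAlgebra.ad A M ν) ^ m = 0) :
    ∃ s : M ≃ₗ[A] M, IsExpAd A ν s :=
  let ⟨s, hs⟩ := exists_lieEquiv_isExpAd hm
  ⟨s.toLinearEquiv, hs⟩

lemma IsExpAd.map_lie {ν : M} {s : M ≃ₗ[A] M} (hs : IsExpAd A ν s) (x y : M) :
    s ⁅x, y⁆ = ⁅s x, s y⁆ := by
  obtain ⟨m, hm, h⟩ := id hs
  obtain ⟨s', hs'⟩ := exists_lieEquiv_isExpAd hm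
  have : ∀ z, s z = s' z := fun z => by rw [hs.apply_eq hm]; exact (hs'.apply_eq hm z).symm
  rw [this, this, this, LieEquiv.map_lie]

/-- Conjugation of a derivation `∂` by `exp (ad ν)` adds to `∂` an inner derivation:
`exp (ad ν) ∘ ∂ = (∂ + ad b) ∘ exp (ad ν)`, where `b = - ∑ (ad ν)ʲ (∂ ν) / (j + 1)!`. -/
lemma IsExpAd.map_derivation {ν : M} {s : M ≃ₗ[A] M} (hs : IsExpAd A ν s) {m : ℕ}
    (hm : (LieAlgebra.ad A M ν) ^ m = 0) (d : M →ₗ[ℂ] M)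
    (hd : ∀ x y, d ⁅x, y⁆ = ⁅d x, y⁆ + ⁅x, d y⁆) (z : M) :
    s (d z) = d (s z) + ⁅-∑ j ∈ Finset.range m,
      (((j + 1).factorial : ℂ)⁻¹) • ((LieAlgebra.ad A M ν) ^ j) (d ν), s z⁆ := by
  let N : Module.End ℂ M := (LieAlgebra.ad A M ν).restrictScalars ℂ
  have hNpow : ∀ k x, (N ^ k) x = ((LieAlgebra.ad A M ν) ^ k) x := by
    intro k
    induction k with
    | zero => intro x; simp
    | succ k ih => intro x; rw [pow_succ, pow_succ, Module.End.mul_apply, ih]; rfl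
  have hN : N ^ m = 0 := by ext x; rw [hNpow, hm]; rfl
  have lie_smulC : ∀ (c : ℂ) (x y : M), ⁅c • x, y⁆ = c • ⁅x, y⁆ := fun c x y => by
    rw [← algebraMap_smul A, smul_lie, algebraMap_smul]
  let _ : Module ℚ (Module.End ℂ M) := Module.compHom _ (algebraMap ℚ ℂ)
  let _ : Module ℚ (Module.End ℂ (Module.End ℂ M)) := Module.compHom _ (algebraMap ℚ ℂ)
  have qsmul : ∀ (q : ℚ) (x : Module.End ℂ M), q • x = (q : ℂ) • x := fun _ _ => rfl
  have qsmul' : ∀ (q : ℚ) (x : Module.End ℂ (Module.End ℂ M)), q • x = (q : ℂ) • x :=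
    fun _ _ => rfl
  -- `exp N ∘ d = exp (ad N) d ∘ exp N`, as left and right multiplication by `N` commute
  let l : Module.End ℂ (Module.End ℂ M) := LinearMap.mulLeft ℂ N
  let r : Module.End ℂ (Module.End ℂ M) := LinearMap.mulRight ℂ N
  have hcomm : Commute l r := LinearMap.commute_mulLeft_right N N
  have hl : IsNilpotent l := ⟨m, by rw [LinearMap.pow_mulLeft, hN]; simp⟩
  have hr : IsNilpotent r := ⟨m, by rw [LinearMap.pow_mulRight, hN]; simp⟩
  have hnN : IsNilpotent N := ⟨m, hN⟩
  have hlr : IsNilpotent (l - r) := hcomm.isNilpotent_sub hl hr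
  have hexp : IsNilpotent.exp l = IsNilpotent.exp r * IsNilpotent.exp (l - r) := by
    rw [← IsNilpotent.exp_add_of_commute
      ((hcomm.symm).sub_right (Commute.refl r)) hr hlr]
    simp
  have hrN : r ^ m = 0 := by rw [LinearMap.pow_mulRight, hN]; simp
  have hlN : l ^ m = 0 := by rw [LinearMap.pow_mulLeft, hN]; simp
  have expl : ∀ X, IsNilpotent.exp l X = IsNilpotent.exp N * X := by
    intro X
    rw [IsNilpotent.exp_eq_sum hlN, IsNilpotent.exp_eq_sum hN, LinearMap.sum_apply,
      Finset.sum_mul]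
    refine Finset.sum_congr rfl fun k _ => ?_
    rw [qsmul, qsmul', LinearMap.pow_mulLeft]
    simp
  have expr : ∀ X, IsNilpotent.exp r X = X * IsNilpotent.exp N := by
    intro X
    rw [IsNilpotent.exp_eq_sum hrN, IsNilpotent.exp_eq_sum hN, LinearMap.sum_apply,
      Finset.mul_sum]
    refine Finset.sum_congr rfl fun k _ => ?_
    rw [qsmul, qsmul', LinearMap.pow_mulRight]
    simp
  have key : IsNilpotent.exp N * d = IsNilpotent.exp (l - r) d * IsNilpotent.exp N := by
    rw [← expl, ← expr, hexp]; rfl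
  have hpow : ∀ j x, (((l - r) ^ (j + 1)) d) x = -⁅((LieAlgebra.ad A M ν) ^ j) (d ν), x⁆ := by
    intro j
    induction j with
    | zero =>
      intro x
      simp [l, r, N, hd]
    | succ j ih =>
      intro x
      rw [pow_succ', Module.End.mul_apply]
      change N ((((l - r) ^ (j + 1)) d) x) - (((l - r) ^ (j + 1)) d) (N x) = _
      rw [ih, ih, pow_succ', Module.End.mul_apply]
      change ⁅ν, _⁆ - -⁅_, ⁅ν, x⁆⁆ = -⁅⁅ν, _⁆, x⁆
      rw [lie_neg, leibniz_lie ν]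
      abel
  have hsN : ∀ x, s x = IsNilpotent.exp N x := by
    intro x
    rw [hs.apply_eq hm, IsNilpotent.exp_eq_sum hN, LinearMap.sum_apply]
    refine Finset.sum_congr rfl fun k _ => ?_
    rw [qsmul, LinearMap.smul_apply, hNpow]
    push_cast
    rfl
  have hD : ∀ x, IsNilpotent.exp (l - r) d x = d x + ⁅-∑ j ∈ Finset.range m,
      (((j + 1).factorial : ℂ)⁻¹) • ((LieAlgebra.ad A M ν) ^ j) (d ν), x⁆ := by
    intro x
    obtain ⟨K, hK⟩ := hlr
    have hK' : (l - r) ^ (K + m + 1) = 0 := pow_eq_zero_of_le (by lia) hK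
    rw [IsNilpotent.exp_eq_sum hK', LinearMap.sum_apply, LinearMap.sum_apply,
      Finset.sum_range_succ', add_comm]
    congr 1
    · rw [qsmul']
      simp
    · rw [sum_range_eq_of_pow_eq_zero hm (pow_eq_zero_of_le (by lia : m ≤ K + m) hm)
        (fun j => (((j + 1).factorial : ℂ)⁻¹)), neg_lie, sum_lie, ← Finset.sum_neg_distrib]
      refine Finset.sum_congr rfl fun j _ => ?_
      rw [qsmul', LinearMap.smul_apply, LinearMap.smul_apply, hpow, lie_smulC]
      push_cast
      rw [smul_neg]
  rw [hsN, hsN, ← hD]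
  exact congr($key z)

end ExpAd

/-! ### Differentiation of Laurent series -/

namespace Laurent

lemma ddt_coeff (f : Laurent) (n : ℤ) :
    HahnSeries.coeff (Laurent.ddt f) n = ((n : ℂ) + 1) * HahnSeries.coeff f (n + 1) := by
  refine (LaurentSeries.hasseDeriv_coeff (R := ℂ) 1 (f : LaurentSeries ℂ) n).trans ?_
  rw [Nat.cast_one, Ring.choose_one_right, zsmul_eq_mul]
  push_cast
  rfl

lemma ddt_ofPowerSeries (f : PowerSeries ℂ) :
    ddt (ofPowerSeries f) = ofPowerSeries (PowerSeries.derivative ℂ f) := by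
  have hneg : ∀ (g : PowerSeries ℂ) (k : ℤ), k < 0 →
      HahnSeries.coeff (HahnSeries.ofPowerSeries ℤ ℂ g) k = 0 := by
    intro g k hk
    rw [HahnSeries.ofPowerSeries_apply, HahnSeries.embDomain_of_notMem_range]
    rintro ⟨m, hm⟩
    have : (m : ℤ) = k := hm
    lia
  refine HahnSeries.ext (funext fun n => ?_)
  rw [ddt_coeff]
  change _ * HahnSeries.coeff (HahnSeries.ofPowerSeries ℤ ℂ f) _ =
    HahnSeries.coeff (HahnSeries.ofPowerSeries ℤ ℂ _) n
  rcases lt_trichotomy n (-1) with hn | rfl | hn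
  · rw [hneg _ _ (by lia), hneg _ _ (by lia), mul_zero]
  · rw [hneg _ (-1) (by lia)]
    simp
  · lift n to ℕ using by lia
    rw [HahnSeries.ofPowerSeries_apply_coeff, PowerSeries.coeff_derivative]
    have := HahnSeries.ofPowerSeries_apply_coeff (Γ := ℤ) f (n + 1)
    push_cast at this
    rw [this]
    push_cast
    ring

lemma coeff_tPow_mul (k : ℤ) (f : Laurent) (n : ℤ) :
    HahnSeries.coeff (tPow k * f) n = HahnSeries.coeff f (n - k) :=
  (HahnSeries.coeff_single_mul (r := (1 : ℂ)) (x := (f : LaurentSeries ℂ))).trans (one_mul _)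

lemma ddt_tPow_mul (k : ℤ) (f : Laurent) :
    ddt (tPow k * f) = (k : ℂ) • (tPow (k - 1) * f) + tPow k * ddt f := by
  refine HahnSeries.ext (funext fun n => ?_)
  change _ = HahnSeries.coeff ((k : ℂ) • (tPow (k - 1) * f)) n + HahnSeries.coeff (tPow k * ddt f) n
  rw [ddt_coeff, coeff_tPow_mul, coeff_tPow_mul, ddt_coeff]
  change _ = (k : ℂ) * HahnSeries.coeff (tPow (k - 1) * f) n + _
  rw [coeff_tPow_mul, show n - (k - 1) = n + 1 - k by lia, show n - k + 1 = n + 1 - k by lia]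
  push_cast
  ring

lemma tPow_mul_tPow (k l : ℤ) : tPow k * tPow l = tPow (k + l) :=
  (HahnSeries.single_mul_single (R := ℂ) (r := 1) (s := 1)).trans
    (congrArg (HahnSeries.single (k + l)) (one_mul (1 : ℂ)))

@[simp]
lemma tPow_zero : tPow 0 = 1 := rfl

lemma ofPowerSeries_X_pow (n : ℕ) : ofPowerSeries (PowerSeries.X ^ n) = tPow n :=
  HahnSeries.ofPowerSeries_X_pow n

lemma ofPowerSeries_injective : Function.Injective ofPowerSeries :=
  HahnSeries.ofPowerSeries_injective

lemma exists_eq_tPow_mul (f : Laurent) : ∃ k p, f = tPow k * ofPowerSeries p :=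
  ⟨_, _, (LaurentSeries.single_order_mul_powerSeriesPart f).symm⟩

/-- The Leibniz rule. -/
lemma ddt_mul (f g : Laurent) : ddt (f * g) = ddt f * g + f * ddt g := by
  obtain ⟨k, p, rfl⟩ := exists_eq_tPow_mul f
  obtain ⟨l, q, rfl⟩ := exists_eq_tPow_mul g
  have h : ddt (ofPowerSeries p * ofPowerSeries q) =
      ddt (ofPowerSeries p) * ofPowerSeries q + ofPowerSeries p * ddt (ofPowerSeries q) := by
    rw [← map_mul, ddt_ofPowerSeries, ddt_ofPowerSeries, ddt_ofPowerSeries, Derivation.leibniz]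
    simp only [smul_eq_mul, map_add, map_mul]
    ring
  rw [show tPow k * ofPowerSeries p * (tPow l * ofPowerSeries q) =
      tPow k * (tPow l * (ofPowerSeries p * ofPowerSeries q)) by ring]
  simp only [ddt_tPow_mul, h, mul_add, add_mul, Algebra.smul_def]
  ring

lemma ddt_one : ddt 1 = 0 := by
  simpa using ddt_mul 1 1

end Laurent

/-! ### Change of coefficients -/

section BaseChange

variable {L : Type*} [LieRing L] [LieAlgebra ℂ L]
  {A B : Type*} [CommRing A] [Algebra ℂ A] [CommRing B] [Algebra ℂ B]

lemma rTensor_lie (φ : A →ₐ[ℂ] B) (x y : A ⊗[ℂ] L) :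
    LinearMap.rTensor L φ.toLinearMap ⁅x, y⁆ =
      ⁅LinearMap.rTensor L φ.toLinearMap x, LinearMap.rTensor L φ.toLinearMap y⁆ :=
  (LieAlgebra.ExtendScalars.map φ (LieHom.id : L →ₗ⁅ℂ⁆ L)).map_lie x y

lemma rTensor_smul (V : Type*) [AddCommGroup V] [Module ℂ V] (φ : A →ₐ[ℂ] B) (a : A)
    (x : A ⊗[ℂ] V) : LinearMap.rTensor V φ.toLinearMap (a • x) =
      φ a • LinearMap.rTensor V φ.toLinearMap x := by
  induction x with
  | zero => simp
  | add x y hx hy => simp only [smul_add, map_add, hx, hy]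
  | tmul b v => simp [TensorProduct.smul_tmul']

lemma rTensor_smul_eq_zero (V : Type*) [AddCommGroup V] [Module ℂ V] (φ : A →ₐ[ℂ] B) {a : A}
    (ha : φ a = 0) (x : A ⊗[ℂ] V) : LinearMap.rTensor V φ.toLinearMap (a • x) = 0 := by
  rw [rTensor_smul, ha, zero_smul]

lemma rTensor_ad_pow (φ : A →ₐ[ℂ] B) (ν x : A ⊗[ℂ] L) (k : ℕ) :
    LinearMap.rTensor L φ.toLinearMap ((LieAlgebra.ad A (A ⊗[ℂ] L) ν ^ k) x) =
      (LieAlgebra.ad B (B ⊗[ℂ] L) (LinearMap.rTensor L φ.toLinearMap ν) ^ k)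
        (LinearMap.rTensor L φ.toLinearMap x) := by
  induction k with
  | zero => simp
  | succ k ih => simp [pow_succ', rTensor_lie, ih]

lemma rTensor_baseChange {V : Type*} [AddCommGroup V] [Module ℂ V] (T : V →ₗ[ℂ] V)
    (φ : A →ₗ[ℂ] B) (x : A ⊗[ℂ] V) :
    LinearMap.rTensor V φ (T.baseChange A x) = T.baseChange B (LinearMap.rTensor V φ x) := by
  induction x with
  | zero => simp
  | add x y hx hy => simp only [map_add, hx, hy]
  | tmul a v => simp

lemma ddt_lie (x y : Laurent ⊗[ℂ] L) :
    LinearMap.rTensor L Laurent.ddt ⁅x, y⁆ =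
      ⁅LinearMap.rTensor L Laurent.ddt x, y⁆ + ⁅x, LinearMap.rTensor L Laurent.ddt y⁆ := by
  induction x with
  | zero => simp
  | add x x' hx hx' => simp only [add_lie, map_add, hx, hx']; abel
  | tmul a u =>
    induction y with
    | zero => simp
    | add y y' hy hy' => simp only [lie_add, map_add, hy, hy']; abel
    | tmul b v => simp [Laurent.ddt_mul, TensorProduct.add_tmul]

lemma ddt_one_tmul (x : L) : LinearMap.rTensor L Laurent.ddt (1 ⊗ₜ[ℂ] x) = 0 := by
  simp [Laurent.ddt_one]

lemma ddt_toLaurent (x : PowerSeries ℂ ⊗[ℂ] L) :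
    LinearMap.rTensor L Laurent.ddt (toLaurent L x) =
      toLaurent L (LinearMap.rTensor L (PowerSeries.derivative ℂ).toLinearMap x) := by
  induction x with
  | zero => simp
  | add x y hx hy => simp only [map_add, hx, hy]
  | tmul a u => simp [toLaurent, Laurent.ddt_ofPowerSeries]

lemma toLaurent_injective : Function.Injective (toLaurent L) :=
  Module.Flat.rTensor_preserves_injective_linearMap _ Laurent.ofPowerSeries_injective

lemma toLaurent_one_tmul (x : L) : toLaurent L (1 ⊗ₜ x) = 1 ⊗ₜ x := by
  simp [toLaurent]

lemma ev_one_tmul (n : ℕ) (x : L) : ev n L (1 ⊗ₜ x) = 1 ⊗ₜ x := by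
  simp only [ev, LinearMap.rTensor_tmul, AlgHom.toLinearMap_apply, map_one]

lemma ev_X_pow_smul (n : ℕ) (V : Type*) [AddCommGroup V] [Module ℂ V] (x : PowerSeries ℂ ⊗[ℂ] V) :
    ev n V ((PowerSeries.X : PowerSeries ℂ) ^ n • x) = 0 :=
  rTensor_smul_eq_zero V _
    (Ideal.Quotient.eq_zero_iff_mem.2 (Ideal.mem_span_singleton_self _)) x

lemma toLaurent_X_pow_smul (n : ℕ) (x : PowerSeries ℂ ⊗[ℂ] L) :
    toLaurent L ((PowerSeries.X : PowerSeries ℂ) ^ n • x) = tPow n • toLaurent L x := by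
  rw [toLaurent, rTensor_smul, Laurent.ofPowerSeries_X_pow]

end BaseChange

/-! ### Gauge transformations -/

section Gauge

variable {L : Type*} [LieRing L] [LieAlgebra ℂ L]

lemma IsGauge.symm {s : (Laurent ⊗[ℂ] L) ≃ₗ[Laurent] (Laurent ⊗[ℂ] L)} {a a' : Laurent ⊗[ℂ] L}
    (h : IsGauge s a a') : IsGauge s⁻¹ a' a := fun m => by
  change s.symm (conn a' (s m)) = conn a m
  rw [← h (s m)]
  simp

lemma IsGauge.trans {s s' : (Laurent ⊗[ℂ] L) ≃ₗ[Laurent] (Laurent ⊗[ℂ] L)}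
    {a a' a'' : Laurent ⊗[ℂ] L} (h : IsGauge s a a') (h' : IsGauge s' a' a'') :
    IsGauge (s' * s) a a'' := fun m => by
  change s' (s (conn a (s.symm (s'.symm m)))) = conn a'' m
  rw [h, h']

lemma isGauge_iff {s : (Laurent ⊗[ℂ] L) ≃ₗ[Laurent] (Laurent ⊗[ℂ] L)}
    (hs : ∀ x y, s ⁅x, y⁆ = ⁅s x, s y⁆) {a a' : Laurent ⊗[ℂ] L} :
    IsGauge s a a' ↔ ∀ m, s (LinearMap.rTensor L Laurent.ddt m) =
      LinearMap.rTensor L Laurent.ddt (s m) + ⁅a' - s a, s m⁆ := by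
  have h1 : IsGauge s a a' ↔ ∀ m, s (conn a m) = conn a' (s m) :=
    ⟨fun h m => by simpa using h (s m), fun h m => by simpa using h (s.symm m)⟩
  rw [h1]
  refine forall_congr' fun m => ?_
  rw [conn, conn, map_add, hs, sub_lie, ← add_sub_assoc, eq_sub_iff_add_eq]

end Gauge

/-! ### Gradings by an inner derivation -/

/-- The eigenspace decomposition of `L` under `ad h`, whose eigenvalues are integers: `proj d` is
the projection to the `d`-eigenspace. -/
structure AdGrading {L : Type*} [LieRing L] [LieAlgebra ℂ L] (h : L) where
  /-- The projection to the eigenspace of an integer. -/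
  proj : ℤ → L →ₗ[ℂ] L
  /-- A bound on the absolute values of the eigenvalues. -/
  bound : ℕ
  proj_eq_zero : ∀ d ∉ Finset.Icc (-bound : ℤ) bound, proj d = 0
  sum_proj : ∀ x, ∑ d ∈ Finset.Icc (-bound : ℤ) bound, proj d x = x
  lie_proj : ∀ d x, ⁅h, proj d x⁆ = (d : ℂ) • proj d x
  proj_of_lie : ∀ (k : ℤ) (x : L), ⁅h, x⁆ = (k : ℂ) • x → ∀ d, proj d x = if d = k then x else 0

namespace AdGrading

variable {L : Type*} [LieRing L] [LieAlgebra ℂ L] {h : L} (G : AdGrading h)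

lemma lie_lie_of_eigen {k l : ℤ} {x y : L} (hx : ⁅h, x⁆ = (k : ℂ) • x) (hy : ⁅h, y⁆ = (l : ℂ) • y) :
    ⁅h, ⁅x, y⁆⁆ = ((k + l : ℤ) : ℂ) • ⁅x, y⁆ := by
  rw [leibniz_lie, hx, hy, smul_lie, lie_smul, ← add_smul]
  push_cast
  rfl

lemma proj_lie (j : ℤ) (x y : L) :
    G.proj j ⁅x, y⁆ = ∑ i ∈ Finset.Icc (-G.bound : ℤ) G.bound, ⁅G.proj i x, G.proj (j - i) y⁆ := by
  conv_lhs => rw [← G.sum_proj x, ← G.sum_proj y]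
  rw [sum_lie, map_sum]
  refine Finset.sum_congr rfl fun i _ => ?_
  rw [lie_sum, map_sum]
  have : ∀ l, G.proj j ⁅G.proj i x, G.proj l y⁆ =
      if l = j - i then ⁅G.proj i x, G.proj (j - i) y⁆ else 0 := by
    intro l
    rw [G.proj_of_lie (i + l) _ (lie_lie_of_eigen (G.lie_proj i x) (G.lie_proj l y))]
    by_cases hl : l = j - i
    · subst hl
      simp
    · rw [if_neg hl, if_neg (by lia)]
  simp only [this, Finset.sum_ite_eq']
  split_ifs with hm
  · rfl
  · rw [G.proj_eq_zero _ hm, LinearMap.zero_apply, lie_zero]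

variable (A : Type*) [CommRing A] [Algebra ℂ A]

/-- The projection of `A ⊗ L` to the `d`-th graded piece. -/
def comp (d : ℤ) : A ⊗[ℂ] L →ₗ[A] A ⊗[ℂ] L := (G.proj d).baseChange A

/-- The filtration of `A ⊗ L` by the elements with no components in degrees less than `k`. -/
def filt (k : ℤ) : Submodule A (A ⊗[ℂ] L) := ⨅ j : {j : ℤ // j < k}, LinearMap.ker (G.comp A j)

variable {A}

lemma mem_filt {k : ℤ} {x : A ⊗[ℂ] L} : x ∈ G.filt A k ↔ ∀ j < k, G.comp A j x = 0 := by
  simp [filt]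

lemma comp_tmul (d : ℤ) (a : A) (x : L) : G.comp A d (a ⊗ₜ x) = a ⊗ₜ G.proj d x := rfl

lemma sum_comp (x : A ⊗[ℂ] L) : ∑ d ∈ Finset.Icc (-G.bound : ℤ) G.bound, G.comp A d x = x := by
  induction x with
  | zero => simp
  | add x y hx hy => simp only [map_add, Finset.sum_add_distrib, hx, hy]
  | tmul a x => simp only [comp_tmul, ← TensorProduct.tmul_sum, G.sum_proj]

lemma comp_eq_zero {d : ℤ} (hd : d ∉ Finset.Icc (-G.bound : ℤ) G.bound) : G.comp A d = 0 := by
  rw [comp, G.proj_eq_zero d hd, LinearMap.baseChange_zero]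

lemma comp_comp (d j : ℤ) (x : A ⊗[ℂ] L) :
    G.comp A d (G.comp A j x) = if d = j then G.comp A j x else 0 := by
  induction x with
  | zero => simp
  | add x y hx hy => simp only [map_add, hx, hy]; split_ifs <;> simp
  | tmul a x =>
    simp only [comp_tmul, G.proj_of_lie j _ (G.lie_proj j x)]
    split_ifs <;> simp

lemma lie_comp (d : ℤ) (x : A ⊗[ℂ] L) :
    ⁅(1 : A) ⊗ₜ[ℂ] h, G.comp A d x⁆ = (d : ℂ) • G.comp A d x := by
  induction x with
  | zero => simp
  | add x y hx hy => simp only [map_add, lie_add, hx, hy, smul_add]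
  | tmul a x => simp [comp_tmul, G.lie_proj]

lemma comp_lie (j : ℤ) (x y : A ⊗[ℂ] L) :
    G.comp A j ⁅x, y⁆ =
      ∑ i ∈ Finset.Icc (-G.bound : ℤ) G.bound, ⁅G.comp A i x, G.comp A (j - i) y⁆ := by
  induction x with
  | zero => simp
  | add x x' hx hx' => simp only [add_lie, map_add, hx, hx', Finset.sum_add_distrib]
  | tmul a u =>
    induction y with
    | zero => simp
    | add y y' hy hy' => simp only [lie_add, map_add, hy, hy', Finset.sum_add_distrib]
    | tmul b v =>
      simp [comp_tmul, G.proj_lie, TensorProduct.tmul_sum]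

lemma comp_lie_left (j : ℤ) (x : A ⊗[ℂ] L) :
    G.comp A j ⁅(1 : A) ⊗ₜ[ℂ] h, x⁆ = (j : ℂ) • G.comp A j x := by
  conv_lhs => rw [← G.sum_comp x]
  rw [lie_sum, map_sum]
  simp only [G.lie_comp, LinearMap.map_smul_of_tower, comp_comp]
  simp only [smul_ite, smul_zero, Finset.sum_ite_eq]
  split_ifs with hj
  · rfl
  · rw [G.comp_eq_zero hj]; simp

/-- Homogeneous elements with respect to an eigenvalue of `ad h` are their own component. -/
lemma comp_one_tmul_of_lie {k : ℤ} {x : L} (hx : ⁅h, x⁆ = (k : ℂ) • x) (a : A) (d : ℤ) :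
    G.comp A d (a ⊗ₜ x) = if d = k then a ⊗ₜ x else 0 := by
  rw [comp_tmul, G.proj_of_lie k x hx]
  split_ifs <;> simp

lemma tmul_mem_filt {k : ℤ} {x : L} (hx : ⁅h, x⁆ = (k : ℂ) • x) (a : A) :
    a ⊗ₜ x ∈ G.filt A k :=
  G.mem_filt.2 fun j hj => by rw [G.comp_one_tmul_of_lie hx, if_neg (by lia)]

lemma comp_mem_filt {k d : ℤ} (hk : k ≤ d) (x : A ⊗[ℂ] L) : G.comp A d x ∈ G.filt A k :=
  G.mem_filt.2 fun j hj => by rw [comp_comp, if_neg (by lia)]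

lemma filt_anti {k l : ℤ} (hkl : k ≤ l) : G.filt A l ≤ G.filt A k := fun x hx =>
  G.mem_filt.2 fun j hj => G.mem_filt.1 hx j (by lia)

lemma smulC_mem_filt {k : ℤ} (c : ℂ) {x : A ⊗[ℂ] L} (hx : x ∈ G.filt A k) : c • x ∈ G.filt A k := by
  rw [← algebraMap_smul A]
  exact Submodule.smul_mem _ _ hx

lemma lie_mem_filt {k l : ℤ} {x y : A ⊗[ℂ] L} (hx : x ∈ G.filt A k) (hy : y ∈ G.filt A l) :
    ⁅x, y⁆ ∈ G.filt A (k + l) := by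
  refine G.mem_filt.2 fun j hj => ?_
  rw [comp_lie]
  refine Finset.sum_eq_zero fun i _ => ?_
  by_cases hi : i < k
  · rw [G.mem_filt.1 hx i hi, zero_lie]
  · rw [G.mem_filt.1 hy (j - i) (by lia), lie_zero]

lemma mem_filt_of_le {k : ℤ} (hk : k ≤ -G.bound) (x : A ⊗[ℂ] L) : x ∈ G.filt A k :=
  G.mem_filt.2 fun j hj => by rw [G.comp_eq_zero (by simp; lia), LinearMap.zero_apply]

lemma eq_zero_of_mem_filt {k : ℤ} (hk : G.bound < k) {x : A ⊗[ℂ] L} (hx : x ∈ G.filt A k) :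
    x = 0 := by
  rw [← G.sum_comp x]
  exact Finset.sum_eq_zero fun d hd => G.mem_filt.1 hx d (by simp at hd; lia)

lemma mem_filt_succ {k : ℤ} {x : A ⊗[ℂ] L} (hx : x ∈ G.filt A k) (hk : G.comp A k x = 0) :
    x ∈ G.filt A (k + 1) := G.mem_filt.2 fun j hj => by
  rcases (show j < k ∨ j = k by lia) with hj | rfl
  · exact G.mem_filt.1 hx j hj
  · exact hk

/-- On elements without components in degrees `≤ c`, the operator `ad h - c` reflects the
filtration. -/
lemma mem_filt_of_lie_sub_smul {c k : ℤ} {x : A ⊗[ℂ] L} (hx : x ∈ G.filt A (c + 1))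
    (hk : ⁅(1 : A) ⊗ₜ[ℂ] h, x⁆ - (c : ℂ) • x ∈ G.filt A k) : x ∈ G.filt A k := by
  refine G.mem_filt.2 fun j hj => ?_
  by_cases hjc : j ≤ c
  · exact G.mem_filt.1 hx j (by lia)
  · have := G.mem_filt.1 hk j hj
    rw [map_sub, comp_lie_left, LinearMap.map_smul_of_tower, ← sub_smul] at this
    have hne : (j : ℂ) - c ≠ 0 := by
      rw [sub_ne_zero]
      exact_mod_cast (show j ≠ c by lia)
    simpa using congrArg (fun z => ((j : ℂ) - c)⁻¹ • z) this |>.symm.trans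
      (by simp [smul_smul, inv_mul_cancel₀ hne]) |>.symm

lemma ad_pow_mem_filt {k d : ℤ} {ν x : A ⊗[ℂ] L} (hν : ν ∈ G.filt A k) (hx : x ∈ G.filt A d)
    (j : ℕ) : (LieAlgebra.ad A (A ⊗[ℂ] L) ν ^ j) x ∈ G.filt A (d + j * k) := by
  induction j with
  | zero => simpa using hx
  | succ j ih =>
    rw [pow_succ', Module.End.mul_apply, LieAlgebra.ad_apply]
    have := G.lie_mem_filt hν ih
    convert! this using 2
    push_cast
    ring

lemma ad_pow_eq_zero {ν : A ⊗[ℂ] L} (hν : ν ∈ G.filt A 1) :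
    LieAlgebra.ad A (A ⊗[ℂ] L) ν ^ (2 * G.bound + 1) = 0 := by
  ext x
  refine G.eq_zero_of_mem_filt (k := G.bound + 1) (by lia) ?_
  have := G.ad_pow_mem_filt hν (G.mem_filt_of_le le_rfl (1 ⊗ₜ x)) (2 * G.bound + 1)
  convert! this using 2
  push_cast
  ring

section Functoriality

variable {B : Type*} [CommRing B] [Algebra ℂ B]

lemma comp_rTensor (φ : A →ₗ[ℂ] B) (d : ℤ) (x : A ⊗[ℂ] L) :
    G.comp B d (LinearMap.rTensor L φ x) = LinearMap.rTensor L φ (G.comp A d x) :=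
  (rTensor_baseChange _ _ _).symm

lemma rTensor_mem_filt (φ : A →ₗ[ℂ] B) {k : ℤ} {x : A ⊗[ℂ] L} (hx : x ∈ G.filt A k) :
    LinearMap.rTensor L φ x ∈ G.filt B k := G.mem_filt.2 fun j hj => by
  rw [comp_rTensor, G.mem_filt.1 hx j hj, map_zero]

end Functoriality

/-- `s` is a Lie algebra automorphism which, for each `d`, is congruent to the identity on the
`d`-th step of the filtration modulo the `(d + k)`-th step. -/
structure IsUnipotent (k : ℤ) (s : (A ⊗[ℂ] L) ≃ₗ[A] (A ⊗[ℂ] L)) : Prop where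
  map_lie : ∀ x y, s ⁅x, y⁆ = ⁅s x, s y⁆
  sub_mem : ∀ d, ∀ x ∈ G.filt A d, s x - x ∈ G.filt A (d + k)

namespace IsUnipotent

variable {G} {k : ℤ} {s s' : (A ⊗[ℂ] L) ≃ₗ[A] (A ⊗[ℂ] L)}

lemma one : G.IsUnipotent k (1 : (A ⊗[ℂ] L) ≃ₗ[A] (A ⊗[ℂ] L)) where
  map_lie _ _ := rfl
  sub_mem d x _ := by simp

lemma mono {l : ℤ} (hkl : l ≤ k) (hs : G.IsUnipotent k s) : G.IsUnipotent l s where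
  map_lie := hs.map_lie
  sub_mem d x hx := G.filt_anti (by lia) (hs.sub_mem d x hx)

lemma mem_filt (hs : G.IsUnipotent k s) (hk : 0 ≤ k) {d : ℤ} {x : A ⊗[ℂ] L}
    (hx : x ∈ G.filt A d) : s x ∈ G.filt A d := by
  rw [← sub_add_cancel (s x) x]
  exact add_mem (G.filt_anti (by lia) (hs.sub_mem d x hx)) hx

lemma mul (hk : 0 ≤ k) (hs : G.IsUnipotent k s) (hs' : G.IsUnipotent k s') :
    G.IsUnipotent k (s * s') where
  map_lie x y := by simp [LinearEquiv.mul_apply, hs.map_lie, hs'.map_lie]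
  sub_mem d x hx := by
    rw [LinearEquiv.mul_apply, ← sub_add_sub_cancel _ (s' x)]
    exact add_mem (hs.sub_mem d _ (hs'.mem_filt hk hx)) (hs'.sub_mem d x hx)

lemma mem_filt_of_apply_mem (hs : G.IsUnipotent k s) (hk : 1 ≤ k) {d : ℤ} {x : A ⊗[ℂ] L}
    (hx : s x ∈ G.filt A d) : x ∈ G.filt A d := by
  have key : ∀ j : ℕ, (-G.bound + j : ℤ) ≤ d → x ∈ G.filt A (-G.bound + j) := by
    intro j
    induction j with
    | zero => exact fun _ => G.mem_filt_of_le (by simp) x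
    | succ j ih =>
      intro hj
      rw [← sub_sub_cancel (s x) x]
      push_cast at hj ⊢
      exact _root_.sub_mem (G.filt_anti hj hx)
        (G.filt_anti (by lia) (hs.sub_mem _ x (ih (by lia))))
  by_cases hd : d ≤ -G.bound
  · exact G.mem_filt_of_le hd x
  · have := key (d + G.bound).toNat (by lia)
    rwa [show (-G.bound + (d + G.bound).toNat : ℤ) = d by lia] at this

lemma inv (hk : 1 ≤ k) (hs : G.IsUnipotent k s) : G.IsUnipotent k s⁻¹ where
  map_lie x y := by
    apply s.injective
    rw [hs.map_lie]
    simp only [← LinearEquiv.mul_apply, mul_inv_cancel]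
    rfl
  sub_mem d x hx := by
    have h1 : s (s⁻¹ x) = x := by rw [← LinearEquiv.mul_apply, mul_inv_cancel]; rfl
    have h2 : s⁻¹ x ∈ G.filt A d := hs.mem_filt_of_apply_mem hk (by rwa [h1])
    have h3 := hs.sub_mem d _ h2
    rw [h1] at h3
    rw [← neg_sub]
    exact neg_mem h3

/-- A unipotent automorphism is as close to the identity as its value at `h` is close to `h`: on an
eigenvector `z` of `ad h`, the equation `[s h, s z] = s [h, z]` determines `s z` from `s h`. -/
lemma of_apply_sub_mem (hs : G.IsUnipotent 1 s)
    (hh : s (1 ⊗ₜ h) - 1 ⊗ₜ h ∈ G.filt A k) : G.IsUnipotent k s where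
  map_lie := hs.map_lie
  sub_mem d x hx := by
    rw [← G.sum_comp x, map_sum, ← Finset.sum_sub_distrib]
    refine sum_mem fun j _ => ?_
    by_cases hj : j < d
    · rw [G.mem_filt.1 hx j hj]
      simp
    · refine G.filt_anti (show d + k ≤ j + k by lia) ?_
      set z := G.comp A j x with hz
      have hzj : z ∈ G.filt A j := G.comp_mem_filt le_rfl x
      have hzh : ⁅(1 : A) ⊗ₜ[ℂ] h, z⁆ = (j : ℂ) • z := G.lie_comp j x
      have h1 : s z - z ∈ G.filt A (j + 1) := hs.sub_mem j z hzj
      refine G.mem_filt_of_lie_sub_smul h1 ?_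
      have h2 : ⁅s (1 ⊗ₜ h), s z⁆ = (j : ℂ) • s z := by
        rw [← hs.map_lie, hzh]
        exact s.toLinearMap.map_smul_of_tower (j : ℂ) z
      have h3 : ⁅(1 : A) ⊗ₜ[ℂ] h, s z - z⁆ - (j : ℂ) • (s z - z) =
          -⁅s (1 ⊗ₜ h) - 1 ⊗ₜ h, s z⁆ := by
        rw [sub_lie, h2, lie_sub, hzh, smul_sub]
        abel
      rw [h3, add_comm]
      exact neg_mem (G.lie_mem_filt hh (hs.mem_filt (by lia) hzj))

end IsUnipotent

lemma isUnipotent_of_isExpAd {k : ℤ} (hk : 1 ≤ k) {ν : A ⊗[ℂ] L} (hν : ν ∈ G.filt A k)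
    {s : (A ⊗[ℂ] L) ≃ₗ[A] (A ⊗[ℂ] L)} (hs : IsExpAd A ν s) : G.IsUnipotent k s where
  map_lie := hs.map_lie
  sub_mem d x hx := by
    rw [hs.apply_eq (G.ad_pow_eq_zero (G.filt_anti hk hν)), Finset.sum_range_succ']
    simp only [pow_zero, Nat.factorial_zero, Nat.cast_one, inv_one, one_smul, Module.End.one_apply,
      add_sub_cancel_right]
    refine sum_mem fun j _ => G.smulC_mem_filt _ ?_
    refine G.filt_anti ?_ (G.ad_pow_mem_filt hν hx (j + 1))
    push_cast
    nlinarith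

lemma isUnipotent_of_mem_expGroup {S : Set (A ⊗[ℂ] L)} (hS : S ⊆ G.filt A 1)
    {s : (A ⊗[ℂ] L) ≃ₗ[A] (A ⊗[ℂ] L)} (hs : s ∈ expGroup A S) : G.IsUnipotent 1 s := by
  induction hs using Subgroup.closure_induction with
  | mem s hs =>
    obtain ⟨ν, hν, h⟩ := hs
    exact G.isUnipotent_of_isExpAd le_rfl (hS hν) h
  | one => exact .one
  | mul s s' _ _ h h' => exact h.mul zero_le_one h'
  | inv s _ h => exact h.inv le_rfl

end AdGrading

/-! ### Gauge equivalent operators with the same order of singularity -/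

section Singular

variable {L : Type*} [LieRing L] [LieAlgebra ℂ L]

/-- In a finite-dimensional Lie algebra without center, an element is a linear function of its
brackets with a basis. -/
lemma exists_eq_sum_lie [FiniteDimensional ℂ L] (hL : ∀ z : L, (∀ y : L, ⁅z, y⁆ = 0) → z = 0) :
    ∃ (T : Fin (Module.finrank ℂ L) → L →ₗ[ℂ] L) (y : Fin (Module.finrank ℂ L) → L),
      ∀ z : L, ∑ i, T i ⁅z, y i⁆ = z := by
  let b := Module.finBasis ℂ L
  let Θ : L →ₗ[ℂ] (Fin (Module.finrank ℂ L) → L) :=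
    LinearMap.pi fun i => -(LieAlgebra.ad ℂ L (b i) : L →ₗ[ℂ] L)
  have hΘ : ∀ z i, Θ z i = ⁅z, b i⁆ := fun z i => by
    simp [Θ]
  have hker : LinearMap.ker Θ = ⊥ := by
    refine LinearMap.ker_eq_bot'.2 fun z hz => hL z fun y => ?_
    rw [← b.sum_repr y, lie_sum]
    refine Finset.sum_eq_zero fun i _ => ?_
    rw [lie_smul, ← hΘ, hz, Pi.zero_apply, smul_zero]
  obtain ⟨T, hT⟩ := Θ.exists_leftInverse_of_injective hker
  refine ⟨fun i => T ∘ₗ LinearMap.single ℂ (fun _ => L) i, b, fun z => ?_⟩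
  simp only [LinearMap.comp_apply, ← hΘ, ← map_sum]
  have : ∑ i, LinearMap.single ℂ (fun _ => L) i (Θ z i) = Θ z := by
    ext i
    simp [Finset.sum_apply, Pi.single_apply]
  rw [this]
  exact congr($hT z)

lemma eq_zero_of_forall_lie_eq_zero [FiniteDimensional ℂ L]
    (hL : ∀ z : L, (∀ y : L, ⁅z, y⁆ = 0) → z = 0) {A : Type*} [CommRing A] [Algebra ℂ A]
    {b : A ⊗[ℂ] L} (hb : ∀ z : L, ⁅b, (1 : A) ⊗ₜ[ℂ] z⁆ = 0) : b = 0 := by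
  obtain ⟨T, y, hT⟩ := exists_eq_sum_lie hL
  have key : ∀ z : A ⊗[ℂ] L, ∑ i, (T i).baseChange A ⁅z, (1 : A) ⊗ₜ[ℂ] y i⁆ = z := by
    intro z
    induction z with
    | zero => simp
    | add z z' hz hz' => simp only [add_lie, map_add, Finset.sum_add_distrib, hz, hz']
    | tmul a z => simp [← TensorProduct.tmul_sum, hT]
  rw [← key b]
  simp [hb]

lemma IsExpAd.rTensor {A B : Type*} [CommRing A] [Algebra ℂ A] [CommRing B] [Algebra ℂ B]
    (φ : A →ₐ[ℂ] B) {ν : A ⊗[ℂ] L} {s : (A ⊗[ℂ] L) ≃ₗ[A] (A ⊗[ℂ] L)}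
    {s' : (B ⊗[ℂ] L) ≃ₗ[B] (B ⊗[ℂ] L)} (hs : IsExpAd A ν s)
    (hs' : IsExpAd B (LinearMap.rTensor L φ.toLinearMap ν) s') {m : ℕ}
    (hm : LieAlgebra.ad A (A ⊗[ℂ] L) ν ^ m = 0)
    (hm' : LieAlgebra.ad B (B ⊗[ℂ] L) (LinearMap.rTensor L φ.toLinearMap ν) ^ m = 0)
    (z : A ⊗[ℂ] L) :
    LinearMap.rTensor L φ.toLinearMap (s z) = s' (LinearMap.rTensor L φ.toLinearMap z) := by
  rw [hs.apply_eq hm, hs'.apply_eq hm', map_sum]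
  exact Finset.sum_congr rfl fun k _ => by rw [map_smul, rTensor_ad_pow]

lemma IsExpAd.toLaurent_apply {ν : PowerSeries ℂ ⊗[ℂ] L}
    {s : (PowerSeries ℂ ⊗[ℂ] L) ≃ₗ[PowerSeries ℂ] (PowerSeries ℂ ⊗[ℂ] L)}
    {s' : (Laurent ⊗[ℂ] L) ≃ₗ[Laurent] (Laurent ⊗[ℂ] L)} (hs : IsExpAd (PowerSeries ℂ) ν s)
    (hs' : IsExpAd Laurent (toLaurent L ν) s') {m : ℕ}
    (hm : LieAlgebra.ad (PowerSeries ℂ) (PowerSeries ℂ ⊗[ℂ] L) ν ^ m = 0)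
    (hm' : LieAlgebra.ad Laurent (Laurent ⊗[ℂ] L) (toLaurent L ν) ^ m = 0)
    (z : PowerSeries ℂ ⊗[ℂ] L) : toLaurent L (s z) = s' (toLaurent L z) :=
  hs.rTensor Laurent.ofPowerSeries hs' hm hm' z

lemma IsExpAd.ev_apply {n : ℕ} {ν : PowerSeries ℂ ⊗[ℂ] L}
    {s : (PowerSeries ℂ ⊗[ℂ] L) ≃ₗ[PowerSeries ℂ] (PowerSeries ℂ ⊗[ℂ] L)}
    {s' : (Jet n ⊗[ℂ] L) ≃ₗ[Jet n] (Jet n ⊗[ℂ] L)} (hs : IsExpAd (PowerSeries ℂ) ν s)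
    (hs' : IsExpAd (Jet n) (ev n L ν) s') {m : ℕ}
    (hm : LieAlgebra.ad (PowerSeries ℂ) (PowerSeries ℂ ⊗[ℂ] L) ν ^ m = 0)
    (hm' : LieAlgebra.ad (Jet n) (Jet n ⊗[ℂ] L) (ev n L ν) ^ m = 0)
    (z : PowerSeries ℂ ⊗[ℂ] L) : ev n L (s z) = s' (ev n L z) :=
  hs.rTensor (Ideal.Quotient.mkₐ ℂ _) hs' hm hm' z

lemma toLaurent_ad_pow (ν x : PowerSeries ℂ ⊗[ℂ] L) (k : ℕ) :
    toLaurent L ((LieAlgebra.ad (PowerSeries ℂ) (PowerSeries ℂ ⊗[ℂ] L) ν ^ k) x) =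
      (LieAlgebra.ad Laurent (Laurent ⊗[ℂ] L) (toLaurent L ν) ^ k) (toLaurent L x) :=
  rTensor_ad_pow Laurent.ofPowerSeries ν x k

lemma toJetAdjointQuotient_apply_eq {n : ℕ} {s : (Jet n ⊗[ℂ] L) ≃ₗ[Jet n] (Jet n ⊗[ℂ] L)}
    (hs : s ∈ expGroup (Jet n) (Set.univ : Set (Jet n ⊗[ℂ] L))) (x : Jet n ⊗[ℂ] L) :
    toJetAdjointQuotient n (s x) = toJetAdjointQuotient n x := by
  ext ⟨F, hF⟩
  have h := PolyFun.mem_invariants.1 hF (s.toLinearMap.restrictScalars ℂ) ⟨s, hs, rfl⟩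
  change PolyFun.eval (s x) F = PolyFun.eval x F
  conv_rhs => rw [← h, PolyFun.eval_pullback]
  rfl

namespace AdGrading

variable {h p : L} (G : AdGrading h)

/-- A gauge transformation by `exp (ad ν)`, for a regular `ν` of positive degree, preserves the form
of an operator with a singularity of order `n`. Modulo `tⁿ` it acts on the coefficients by
conjugation alone, because the term coming from the derivative of `ν` is divisible by `tⁿ`. -/
lemma exists_gauge_exp (hp : ⁅h, p⁆ = -p) (n : ℕ) {ν : PowerSeries ℂ ⊗[ℂ] L}
    (hν : ν ∈ G.filt (PowerSeries ℂ) 1) {x : PowerSeries ℂ ⊗[ℂ] L}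
    (hx : x ∈ G.filt (PowerSeries ℂ) 0) :
    ∃ s, IsExpAd Laurent (toLaurent L ν) s ∧ ∃ y ∈ G.filt (PowerSeries ℂ) 0,
      IsGauge s (singPart n p x) (singPart n p y) ∧
        toJetAdjointQuotient n (1 ⊗ₜ p + ev n L x) =
          toJetAdjointQuotient n (1 ⊗ₜ p + ev n L y) := by
  set m := 2 * G.bound + 1
  have hm := G.ad_pow_eq_zero hν
  have hm₁ : LieAlgebra.ad Laurent _ (toLaurent L ν) ^ m = 0 :=
    G.ad_pow_eq_zero (G.rTensor_mem_filt Laurent.ofPowerSeries.toLinearMap hν)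
  have hm₂ : LieAlgebra.ad (Jet n) _ (ev n L ν) ^ m = 0 :=
    G.ad_pow_eq_zero (G.rTensor_mem_filt (Ideal.Quotient.mkₐ ℂ _).toLinearMap hν)
  obtain ⟨s₀, hs₀⟩ := exists_isExpAd hm
  obtain ⟨s₁, hs₁⟩ := exists_isExpAd hm₁
  obtain ⟨s₂, hs₂⟩ := exists_isExpAd hm₂
  let dν : PowerSeries ℂ ⊗[ℂ] L := LinearMap.rTensor L (PowerSeries.derivative ℂ).toLinearMap ν
  have hdν : dν ∈ G.filt (PowerSeries ℂ) 1 := G.rTensor_mem_filt _ hν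
  let β : PowerSeries ℂ ⊗[ℂ] L := -∑ j ∈ Finset.range m,
    (((j + 1).factorial : ℂ)⁻¹) • ((LieAlgebra.ad (PowerSeries ℂ) _ ν) ^ j) dν
  let y : PowerSeries ℂ ⊗[ℂ] L :=
    s₀ (1 ⊗ₜ p + x) - 1 ⊗ₜ p + (PowerSeries.X : PowerSeries ℂ) ^ n • β
  have hβ : β ∈ G.filt (PowerSeries ℂ) 0 := neg_mem <| sum_mem fun j _ =>
    G.smulC_mem_filt _ (G.filt_anti (by lia) (G.ad_pow_mem_filt hν hdν j))
  have hU := G.isUnipotent_of_isExpAd le_rfl hν hs₀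
  have hp' : (1 : PowerSeries ℂ) ⊗ₜ[ℂ] p ∈ G.filt (PowerSeries ℂ) (-1) :=
    G.tmul_mem_filt (by simpa using hp) 1
  have hy : y ∈ G.filt (PowerSeries ℂ) 0 := by
    refine add_mem ?_ (Submodule.smul_mem _ _ hβ)
    rw [map_add, add_sub_right_comm]
    have h1 := hU.sub_mem (-1) _ hp'
    rw [neg_add_cancel] at h1
    exact add_mem h1 (hU.mem_filt zero_le_one hx)
  have hpy : 1 ⊗ₜ p + y = s₀ (1 ⊗ₜ p + x) + (PowerSeries.X : PowerSeries ℂ) ^ n • β := by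
    simp only [y]
    abel
  refine ⟨s₁, hs₁, y, hy, ?_, ?_⟩
  · rw [isGauge_iff hs₁.map_lie]
    intro z
    rw [hs₁.map_derivation hm₁ (LinearMap.rTensor L Laurent.ddt) ddt_lie z]
    congr 2
    have e1 : toLaurent L (s₀ (1 ⊗ₜ p + x)) = s₁ (1 ⊗ₜ p + toLaurent L x) := by
      rw [← toLaurent_one_tmul p, ← map_add]
      exact hs₀.toLaurent_apply hs₁ hm hm₁ _
    have e2 : toLaurent L β = -∑ j ∈ Finset.range m, (((j + 1).factorial : ℂ)⁻¹) •
        ((LieAlgebra.ad Laurent _ (toLaurent L ν)) ^ j)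
          (LinearMap.rTensor L Laurent.ddt (toLaurent L ν)) := by
      simp only [β, map_neg, map_sum, map_smul, ddt_toLaurent]
      congr 1
      exact Finset.sum_congr rfl fun j _ => by
        rw [toLaurent_ad_pow]
    rw [← e2, singPart, singPart, map_smul, ← e1, ← smul_sub, ← toLaurent_one_tmul p, ← map_add,
      hpy, map_add, add_sub_cancel_left, toLaurent_X_pow_smul, smul_smul, Laurent.tPow_mul_tPow,
      neg_add_cancel, Laurent.tPow_zero, one_smul]
  · have e1 : 1 ⊗ₜ p + ev n L y = s₂ (1 ⊗ₜ p + ev n L x) := by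
      rw [← ev_one_tmul n p, ← map_add, ← map_add, hpy, map_add, ev_X_pow_smul, add_zero]
      exact hs₀.ev_apply hs₂ hm hm₂ _
    rw [e1]
    exact (toJetAdjointQuotient_apply_eq
      (Subgroup.subset_closure ⟨_, Set.mem_univ _, hs₂⟩) _).symm

end AdGrading

end Singular

/-! ### The residue is unchanged by unipotent gauge transformations -/

namespace AdGrading

section

variable {L : Type*} [LieRing L] [LieAlgebra ℂ L] {h p : L} (G : AdGrading h)

/-- If `s ∘ ∂ ∘ s⁻¹ = ∂ + ad b` for `s` unipotent of step `k`, then `b` has degree at least `k`. The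
degree zero part of `b` vanishes because it is central; in the other degrees `b` is determined by
its bracket with `s h`, which is the derivative of `h - s h`. -/
lemma mem_filt_of_isUnipotent [FiniteDimensional ℂ L]
    (hL : ∀ z : L, (∀ y : L, ⁅z, y⁆ = 0) → z = 0) {k : ℤ} (hk : 1 ≤ k)
    {s : (Laurent ⊗[ℂ] L) ≃ₗ[Laurent] (Laurent ⊗[ℂ] L)} (hs : G.IsUnipotent k s)
    {b : Laurent ⊗[ℂ] L} (hb0 : b ∈ G.filt Laurent 0)
    (hb : ∀ m, s (LinearMap.rTensor L Laurent.ddt m) =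
      LinearMap.rTensor L Laurent.ddt (s m) + ⁅b, s m⁆) : b ∈ G.filt Laurent k := by
  have hddt : ∀ z : L, ⁅b, s (1 ⊗ₜ z)⁆ =
      -LinearMap.rTensor L Laurent.ddt (s (1 ⊗ₜ z) - 1 ⊗ₜ z) := by
    intro z
    have := hb (1 ⊗ₜ z)
    rw [ddt_one_tmul, map_zero] at this
    rw [map_sub, ddt_one_tmul, sub_zero]
    exact eq_neg_of_add_eq_zero_right this.symm
  have hlie : ∀ (d : ℤ) (z : L), ⁅h, z⁆ = (d : ℂ) • z →
      ⁅b, (1 : Laurent) ⊗ₜ[ℂ] z⁆ ∈ G.filt Laurent (d + k) := by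
    intro d z hz
    have h1 := hs.sub_mem d _ (G.tmul_mem_filt hz 1)
    have h2 : ⁅b, (1 : Laurent) ⊗ₜ[ℂ] z⁆ =
        ⁅b, s (1 ⊗ₜ z)⁆ - ⁅b, s (1 ⊗ₜ z) - 1 ⊗ₜ z⁆ := by
      rw [lie_sub]
      abel
    rw [h2, hddt]
    refine sub_mem (neg_mem (G.rTensor_mem_filt _ h1)) ?_
    have := G.lie_mem_filt hb0 h1
    rwa [zero_add] at this
  have hb1 : G.comp Laurent 0 b = 0 := by
    apply eq_zero_of_forall_lie_eq_zero hL
    intro z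
    rw [← G.sum_proj z, TensorProduct.tmul_sum, lie_sum]
    refine Finset.sum_eq_zero fun d hd => ?_
    have h1 := hlie d (G.proj d z) (G.lie_proj d z)
    have h2 := G.mem_filt.1 h1 d (by lia)
    rw [comp_lie, Finset.sum_eq_single 0] at h2
    · rwa [sub_zero, comp_tmul, G.proj_of_lie d _ (G.lie_proj d z), if_pos rfl] at h2
    · intro i _ hi
      rw [comp_tmul, G.proj_of_lie d _ (G.lie_proj d z), if_neg (by lia), TensorProduct.tmul_zero,
        lie_zero]
    · intro h0
      simp at h0
  have h1 := hlie 0 h (by simp)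
  refine G.mem_filt_of_lie_sub_smul (c := 0) (G.mem_filt_succ hb0 hb1) ?_
  rw [Int.cast_zero, zero_smul, sub_zero, ← lie_skew]
  rw [zero_add] at h1
  exact neg_mem h1

/-- The leading term of a unipotent automorphism of step `k` is `ad ν`, where `-k ν` is the leading
term of `s h - h`; this is its effect on an eigenvector `p` of `ad h` with eigenvalue `-1`. -/
lemma apply_sub_sub_lie_mem_filt {A : Type*} [CommRing A] [Algebra ℂ A] (hp : ⁅h, p⁆ = -p) {k : ℤ}
    (hk : 1 ≤ k) {s : (A ⊗[ℂ] L) ≃ₗ[A] (A ⊗[ℂ] L)} (hs : G.IsUnipotent k s) {ν : A ⊗[ℂ] L}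
    (hν : ⁅(1 : A) ⊗ₜ[ℂ] h, ν⁆ = (k : ℂ) • ν) (hνk : ν ∈ G.filt A k)
    (hsν : s (1 ⊗ₜ h) - 1 ⊗ₜ h + (k : ℂ) • ν ∈ G.filt A (k + 1)) :
    s (1 ⊗ₜ p) - 1 ⊗ₜ p - ⁅ν, (1 : A) ⊗ₜ[ℂ] p⁆ ∈ G.filt A k := by
  have hpA : ⁅(1 : A) ⊗ₜ[ℂ] h, (1 : A) ⊗ₜ[ℂ] p⁆ = -(1 ⊗ₜ p) := by
    simp [hp, TensorProduct.tmul_neg]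
  have hp' : (1 : A) ⊗ₜ[ℂ] p ∈ G.filt A (-1) := G.tmul_mem_filt (by simpa using hp) 1
  have hu : s (1 ⊗ₜ p) - 1 ⊗ₜ p ∈ G.filt A (k - 1) := by
    have := hs.sub_mem _ _ hp'
    rwa [neg_add_eq_sub] at this
  have hh : (1 : A) ⊗ₜ[ℂ] h ∈ G.filt A 0 := G.tmul_mem_filt (by simp) 1
  have hr : s (1 ⊗ₜ h) - 1 ⊗ₜ h ∈ G.filt A k := by
    have := hs.sub_mem _ _ hh
    rwa [zero_add] at this
  have hνp : ⁅ν, (1 : A) ⊗ₜ[ℂ] p⁆ ∈ G.filt A (k - 1) := G.lie_mem_filt hνk hp'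
  refine G.mem_filt_of_lie_sub_smul (c := -1)
    (G.filt_anti (by lia) (sub_mem hu hνp)) ?_
  set u := s (1 ⊗ₜ p) - 1 ⊗ₜ p with hu_def
  set r := s (1 ⊗ₜ h) - 1 ⊗ₜ h with hr_def
  have e1 : ⁅1 ⊗ₜ h + r, 1 ⊗ₜ p + u⁆ = -(1 ⊗ₜ p + u) := by
    rw [hu_def, hr_def, add_sub_cancel, add_sub_cancel, ← hs.map_lie, hpA, map_neg]
  have e2 : ⁅(1 : A) ⊗ₜ[ℂ] h, ⁅ν, (1 : A) ⊗ₜ[ℂ] p⁆⁆ = ((k : ℂ) - 1) • ⁅ν, (1 : A) ⊗ₜ[ℂ] p⁆ := by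
    rw [leibniz_lie, hν, hpA, lie_neg, ← algebraMap_smul A (k : ℂ) ν, smul_lie, algebraMap_smul,
      sub_smul, one_smul, sub_eq_add_neg]
  have e3 : ⁅(1 : A) ⊗ₜ[ℂ] h, u⁆ + u = -⁅r, (1 : A) ⊗ₜ[ℂ] p⁆ - ⁅r, u⁆ := by
    simp only [add_lie, lie_add, hpA] at e1
    rw [← sub_eq_zero] at e1 ⊢
    rw [← e1]
    abel
  have e4 : ⁅(k : ℂ) • ν, (1 : A) ⊗ₜ[ℂ] p⁆ = (k : ℂ) • ⁅ν, (1 : A) ⊗ₜ[ℂ] p⁆ := by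
    rw [← algebraMap_smul A (k : ℂ) ν, smul_lie, algebraMap_smul]
  have e5 : ⁅(1 : A) ⊗ₜ[ℂ] h, u - ⁅ν, (1 : A) ⊗ₜ[ℂ] p⁆⁆ - (((-1 : ℤ) : ℂ)) •
      (u - ⁅ν, (1 : A) ⊗ₜ[ℂ] p⁆) = -⁅r + (k : ℂ) • ν, (1 : A) ⊗ₜ[ℂ] p⁆ - ⁅r, u⁆ := by
    rw [lie_sub, e2, add_lie, e4, sub_smul, one_smul, eq_sub_of_add_eq e3]
    push_cast
    rw [neg_smul, one_smul]
    abel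
  rw [e5]
  refine sub_mem (neg_mem ?_) (G.filt_anti (by lia) (G.lie_mem_filt hr hu))
  have := G.lie_mem_filt hsν hp'
  rwa [add_neg_cancel_right] at this

lemma exists_leftInverse_lie {k : ℤ}
    (hinj : ∀ z : L, ⁅h, z⁆ = (k : ℂ) • z → ⁅z, p⁆ = 0 → z = 0) :
    ∃ T : L →ₗ[ℂ] L, ∀ (A : Type) [CommRing A] [Algebra ℂ A] (z : A ⊗[ℂ] L),
      T.baseChange A ⁅G.comp A k z, (1 : A) ⊗ₜ[ℂ] p⁆ = G.comp A k z := by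
  let E := LinearMap.range (G.proj k)
  let θ : E →ₗ[ℂ] L := (-(LieAlgebra.ad ℂ L p : L →ₗ[ℂ] L)) ∘ₗ E.subtype
  have hθ : ∀ z : E, θ z = ⁅(z : L), p⁆ := fun z => by simp [θ]
  have hker : LinearMap.ker θ = ⊥ := by
    refine LinearMap.ker_eq_bot'.2 fun z hz => ?_
    obtain ⟨_, z, rfl⟩ := z
    rw [hθ] at hz
    exact Subtype.ext (hinj _ (G.lie_proj k z) hz)
  obtain ⟨T, hT⟩ := θ.exists_leftInverse_of_injective hker
  refine ⟨E.subtype ∘ₗ T, fun A _ _ z => ?_⟩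
  have hT' : ∀ z : L, T ⁅G.proj k z, p⁆ = ⟨G.proj k z, z, rfl⟩ := fun z => by
    have := hθ ⟨G.proj k z, z, rfl⟩
    dsimp only at this
    rw [← this]
    exact congr($hT _)
  induction z with
  | zero => simp
  | add z z' hz hz' => simp only [map_add, add_lie, hz, hz']
  | tmul a z => simp [comp_tmul, hT']

/-- Two operators with a singularity of order `n` that are conjugate under the unipotent group over
`ℂ((t))` have the same residue. The leading term `ν` of the conjugating element is regular because
`[ν, p]` is, `ad p` being injective in positive degrees; dividing by `exp (ad ν)`, which does not
change the residue, moves the conjugating element closer to the identity. -/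
theorem toJetAdjointQuotient_eq_of_isGauge [FiniteDimensional ℂ L]
    (hL : ∀ z : L, (∀ y : L, ⁅z, y⁆ = 0) → z = 0) (hp : ⁅h, p⁆ = -p)
    (hinj : ∀ k : ℤ, 1 ≤ k → ∀ z : L, ⁅h, z⁆ = (k : ℂ) • z → ⁅z, p⁆ = 0 → z = 0) (n : ℕ)
    {x y : PowerSeries ℂ ⊗[ℂ] L} (hx : x ∈ G.filt (PowerSeries ℂ) 0)
    (hy : y ∈ G.filt (PowerSeries ℂ) 0)
    {s : (Laurent ⊗[ℂ] L) ≃ₗ[Laurent] (Laurent ⊗[ℂ] L)} (hs : G.IsUnipotent 1 s)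
    (hg : IsGauge s (singPart n p x) (singPart n p y)) :
    toJetAdjointQuotient n (1 ⊗ₜ p + ev n L x) = toJetAdjointQuotient n (1 ⊗ₜ p + ev n L y) := by
  suffices H : ∀ (N : ℕ) (k : ℤ), 1 ≤ k → 2 * G.bound + 1 ≤ k + N →
      ∀ (x : PowerSeries ℂ ⊗[ℂ] L), x ∈ G.filt (PowerSeries ℂ) 0 →
      ∀ s : (Laurent ⊗[ℂ] L) ≃ₗ[Laurent] (Laurent ⊗[ℂ] L), G.IsUnipotent k s →
        IsGauge s (singPart n p x) (singPart n p y) →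
        toJetAdjointQuotient n (1 ⊗ₜ p + ev n L x) = toJetAdjointQuotient n (1 ⊗ₜ p + ev n L y) from
    H (2 * G.bound + 1) 1 le_rfl (by push_cast; lia) x hx s hs hg
  clear hg hs s hx x
  have htp : ∀ z : Laurent ⊗[ℂ] L, tPow n • tPow (-n) • z = z := fun z => by
    rw [smul_smul, Laurent.tPow_mul_tPow, add_neg_cancel, Laurent.tPow_zero, one_smul]
  have htL : ∀ {z : PowerSeries ℂ ⊗[ℂ] L} {k : ℤ}, z ∈ G.filt (PowerSeries ℂ) k →
      toLaurent L z ∈ G.filt Laurent k := fun hz => G.rTensor_mem_filt _ hz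
  have hcL : ∀ (z : PowerSeries ℂ ⊗[ℂ] L) (k : ℤ),
      G.comp Laurent k (toLaurent L z) = toLaurent L (G.comp (PowerSeries ℂ) k z) :=
    fun z k => G.comp_rTensor _ k z
  have hpL : (1 : Laurent) ⊗ₜ[ℂ] p ∈ G.filt Laurent (-1) := G.tmul_mem_filt (by simpa using hp) 1
  have hhL : (1 : Laurent) ⊗ₜ[ℂ] h ∈ G.filt Laurent 0 := G.tmul_mem_filt (by simp) 1
  intro N
  induction N with
  | zero =>
    intro k hk hkN x hx s hs hg
    -- here `s` is the identity
    have hs1 : ∀ z, s z = z := fun z => by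
      have := hs.sub_mem _ z (G.mem_filt_of_le le_rfl z)
      exact sub_eq_zero.1 (G.eq_zero_of_mem_filt (by push_cast at hkN; lia) this)
    have hs2 := (isGauge_iff hs.map_lie).1 hg
    have hxy : singPart n p y - singPart n p x = 0 := by
      apply eq_zero_of_forall_lie_eq_zero hL
      intro z
      have := hs2 (1 ⊗ₜ z)
      simpa [hs1] using this
    have hxy' : toLaurent L x = toLaurent L y := by
      have := congrArg (fun z => tPow n • z) (sub_eq_zero.1 hxy)
      simp only [singPart, htp] at this
      exact (add_left_cancel this).symm
    rw [toLaurent_injective hxy']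
  | succ N ih =>
    intro k hk hkN x hx s hs hg
    have hk0 : (k : ℂ) ≠ 0 := by exact_mod_cast (show k ≠ 0 by lia)
    have hs1 : ∀ z ∈ G.filt Laurent 0, s z - z ∈ G.filt Laurent k := fun z hz => by
      have := hs.sub_mem 0 z hz
      rwa [zero_add] at this
    set r := s (1 ⊗ₜ h) - 1 ⊗ₜ h with hr_def
    have hr : r ∈ G.filt Laurent k := hs1 _ hhL
    let ν : Laurent ⊗[ℂ] L := -((k : ℂ)⁻¹ • G.comp Laurent k r)
    have hνcomp : G.comp Laurent k ν = ν := by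
      simp only [ν, map_neg, LinearMap.map_smul_of_tower, comp_comp, if_true]
    have hν : ⁅(1 : Laurent) ⊗ₜ[ℂ] h, ν⁆ = (k : ℂ) • ν := by
      rw [← hνcomp, G.lie_comp]
    have hνk : ν ∈ G.filt Laurent k := by
      rw [← hνcomp]
      exact G.comp_mem_filt le_rfl ν
    have hkν : (k : ℂ) • ν = -G.comp Laurent k r := by
      simp only [ν, smul_neg, smul_smul, mul_inv_cancel₀ hk0, one_smul]
    have hrν : r + (k : ℂ) • ν ∈ G.filt Laurent (k + 1) := by
      refine G.mem_filt_succ (add_mem hr (G.smulC_mem_filt _ hνk)) ?_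
      rw [hkν, map_add, map_neg, comp_comp, if_pos rfl, add_neg_cancel]
    clear_value ν
    -- the degree `k - 1` part of the gauge equation shows that `[ν, p]` is regular
    have hbx : ∃ b ∈ G.filt Laurent k, singPart n p y = s (singPart n p x) + b := by
      refine ⟨singPart n p y - s (singPart n p x), ?_, by abel⟩
      refine G.mem_filt_of_isUnipotent hL hk hs ?_ ((isGauge_iff hs.map_lie).1 hg)
      have e : singPart n p y - s (singPart n p x) =
          tPow (-n) • (toLaurent L y - toLaurent L x - (s (1 ⊗ₜ p) - 1 ⊗ₜ p) -
            (s (toLaurent L x) - toLaurent L x)) := by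
        simp only [singPart, map_smul, map_add, ← smul_sub]
        congr 1
        abel
      rw [e]
      refine Submodule.smul_mem _ _ (sub_mem (sub_mem (sub_mem (htL hy) (htL hx)) ?_) ?_)
      · exact G.filt_anti (by lia) (hs.sub_mem _ _ hpL)
      · exact G.filt_anti (by lia) (hs1 _ (htL hx))
    have hνp : ⁅ν, (1 : Laurent) ⊗ₜ[ℂ] p⁆ =
        toLaurent L (G.comp (PowerSeries ℂ) (k - 1) (y - x)) := by
      obtain ⟨b, hb, e⟩ := hbx
      have e1 : toLaurent L (y - x) - ⁅ν, (1 : Laurent) ⊗ₜ[ℂ] p⁆ =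
          (s (1 ⊗ₜ p) - 1 ⊗ₜ p - ⁅ν, (1 : Laurent) ⊗ₜ[ℂ] p⁆) +
            (s (toLaurent L x) - toLaurent L x) + tPow n • b := by
        have := congrArg (fun z => tPow n • z) e
        simp only [singPart, map_smul, map_add, smul_add, htp] at this
        rw [map_sub, eq_sub_of_add_eq' this]
        abel
      have e2 : toLaurent L (y - x) - ⁅ν, (1 : Laurent) ⊗ₜ[ℂ] p⁆ ∈ G.filt Laurent k := by
        rw [e1]
        exact add_mem (add_mem (G.apply_sub_sub_lie_mem_filt hp hk hs hν hνk hrν)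
          (hs1 _ (htL hx))) (Submodule.smul_mem _ _ hb)
      have e3 := G.mem_filt.1 e2 (k - 1) (by lia)
      rw [map_sub, hcL, sub_eq_zero] at e3
      rw [e3, comp_lie, Finset.sum_eq_single k]
      · rw [hνcomp, comp_one_tmul_of_lie (k := -1) G (by simpa using hp), if_pos (by lia)]
      · intro i _ hi
        rw [← hνcomp, comp_comp, if_neg hi, zero_lie]
      · intro hkb
        rw [G.comp_eq_zero hkb, LinearMap.zero_apply, zero_lie]
    obtain ⟨T, hT⟩ := G.exists_leftInverse_lie (hinj k hk)
    let ν₀ : PowerSeries ℂ ⊗[ℂ] L := G.comp (PowerSeries ℂ) k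
      (T.baseChange (PowerSeries ℂ) (G.comp (PowerSeries ℂ) (k - 1) (y - x)))
    have hν₀ : toLaurent L ν₀ = ν := by
      simp only [ν₀]
      rw [← hcL, toLaurent, rTensor_baseChange, ← toLaurent, ← hνp, ← hνcomp, hT, hνcomp, hνcomp]
    have hν₀k : ν₀ ∈ G.filt (PowerSeries ℂ) k := G.comp_mem_filt le_rfl _
    obtain ⟨e, he, x', hx', hge, hres⟩ := G.exists_gauge_exp hp n (G.filt_anti hk hν₀k) hx
    rw [hν₀] at he
    rw [hres]
    have hadh : LieAlgebra.ad Laurent _ ν ((1 : Laurent) ⊗ₜ[ℂ] h) = -((k : ℂ) • ν) := by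
      rw [LieAlgebra.ad_apply, ← lie_skew, hν]
    have hadν : LieAlgebra.ad Laurent (Laurent ⊗[ℂ] L) ν ((k : ℂ) • ν) = 0 := by
      rw [LinearMap.map_smul_of_tower, LieAlgebra.ad_apply, lie_self, smul_zero]
    have heh : e (1 ⊗ₜ h + (k : ℂ) • ν) = 1 ⊗ₜ h := by
      have hm : LieAlgebra.ad Laurent (Laurent ⊗[ℂ] L) ν ^ (2 * G.bound + 1 + 1) = 0 := by
        rw [pow_succ, G.ad_pow_eq_zero (G.filt_anti hk hνk), zero_mul]
      rw [he.apply_eq hm, Finset.sum_range_succ', Finset.sum_range_succ', Finset.sum_eq_zero]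
      · simp only [pow_zero, Module.End.one_apply, zero_add, pow_one, map_add, hadh, hadν]
        simp
      · intro j _
        rw [pow_succ, pow_succ, Module.End.mul_apply, Module.End.mul_apply, map_add, hadh, hadν,
          add_zero, map_neg, hadν, neg_zero, map_zero, smul_zero]
    have heh' : e⁻¹ (1 ⊗ₜ h) = 1 ⊗ₜ h + (k : ℂ) • ν := e.symm_apply_eq.2 heh.symm
    have hs' : G.IsUnipotent k (s * e⁻¹) :=
      hs.mul (by lia) ((G.isUnipotent_of_isExpAd hk hνk he).inv hk)
    refine ih (k + 1) (by lia) (by push_cast at hkN ⊢; lia) x' hx' (s * e⁻¹) ?_ (hge.symm.trans hg)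
    refine IsUnipotent.of_apply_sub_mem (hs'.mono hk) ?_
    have e1 : (s * e⁻¹) (1 ⊗ₜ h) - 1 ⊗ₜ h = (r + (k : ℂ) • ν) + (k : ℂ) • (s ν - ν) := by
      rw [LinearEquiv.mul_apply, heh', map_add, hr_def, smul_sub,
        show s ((k : ℂ) • ν) = (k : ℂ) • s ν from s.toLinearMap.map_smul_of_tower _ _]
      abel
    rw [e1]
    exact add_mem hrν (G.smulC_mem_filt _ (G.filt_anti (by lia) (hs.sub_mem k ν hνk)))

end

end AdGrading

/-! ### Infinitesimal invariance and functions on jets -/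

section Invariance

variable {A : Type*} [CommRing A] [Algebra ℂ A] {M : Type*} [LieRing M] [LieAlgebra A M]
  [Module ℂ M] [IsScalarTower ℂ A M]

/-- A function invariant under the adjoint group is annihilated by the vector fields of nilpotent
elements. -/
lemma der_ad_eq_zero_of_pow_eq_zero [FiniteDimensional ℂ M] {F : PolyFun M}
    (hF : ∀ s ∈ expGroup A (Set.univ : Set M), ∀ x, PolyFun.eval (s x) F = PolyFun.eval x F)
    {ν : M} {m : ℕ} (hm : LieAlgebra.ad A M ν ^ m = 0) :
    PolyFun.der ((LieAlgebra.ad A M ν).restrictScalars ℂ) F = 0 := by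
  have hpow : ∀ (T : Module.End A M) (k : ℕ) (x : M), (T.restrictScalars ℂ ^ k : Module.End ℂ M) x =
      (T ^ k) x := by
    intro T k
    induction k with
    | zero => intro x; simp
    | succ k ih => intro x; rw [pow_succ, pow_succ, Module.End.mul_apply, ih]; rfl
  refine PolyFun.der_eq_zero_of_forall_exp (T := (LieAlgebra.ad A M ν).restrictScalars ℂ) (m := m)
    (by ext x; rw [hpow, hm]; rfl) fun c x => ?_
  have hc : LieAlgebra.ad A M (c • ν) ^ m = 0 := by
    rw [← algebraMap_smul A c ν, map_smul, smul_pow, hm, smul_zero]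
  obtain ⟨s, hs⟩ := exists_isExpAd hc
  rw [← hF s (Subgroup.subset_closure ⟨_, Set.mem_univ _, hs⟩) x, hs.apply_eq hc]
  congr 2
  refine Finset.sum_congr rfl fun k _ => ?_
  congr 1
  rw [← hpow]
  congr 2
  ext x
  change c • ⁅ν, x⁆ = ⁅c • ν, x⁆
  rw [← algebraMap_smul A c ν, smul_lie, algebraMap_smul]

/-- The Lie algebra `L` is generated by its ad-nilpotent elements. -/
def GeneratedByNilpotents (L : Type*) [LieRing L] [LieAlgebra ℂ L] : Prop :=
  ∀ S : Submodule ℂ L, (∀ y, IsNilpotent (LieAlgebra.ad ℂ L y) → y ∈ S) →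
    (∀ x ∈ S, ∀ y ∈ S, ⁅x, y⁆ ∈ S) → S = ⊤

/-- The elements of `L` whose vector fields annihilate `F` form a Lie subalgebra. -/
lemma der_ad_eq_zero {L : Type*} [LieRing L] [LieAlgebra ℂ L]
    (hgen : GeneratedByNilpotents L)
    [FiniteDimensional ℂ M] {F : PolyFun M}
    (hF : ∀ s ∈ expGroup A (Set.univ : Set M), ∀ x, PolyFun.eval (s x) F = PolyFun.eval x F)
    (j : L →ₗ[ℂ] M) (hj : ∀ x y, j ⁅x, y⁆ = ⁅j x, j y⁆)
    (hjn : ∀ y, IsNilpotent (LieAlgebra.ad ℂ L y) → IsNilpotent (LieAlgebra.ad A M (j y)))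
    (y : L) : PolyFun.der ((LieAlgebra.ad A M (j y)).restrictScalars ℂ) F = 0 := by
  let T : L →ₗ[ℂ] Module.End ℂ M :=
    { toFun := fun y => (LieAlgebra.ad A M (j y)).restrictScalars ℂ
      map_add' := fun x y => by ext; simp
      map_smul' := fun c x => by
        ext z
        change ⁅j (c • x), z⁆ = c • ⁅j x, z⁆
        rw [map_smul, ← algebraMap_smul A c (j x), smul_lie, algebraMap_smul] }
  have htop := hgen ((PolyFun.annihilator F).comap T) (fun y hy => by
      obtain ⟨m, hm⟩ := hjn y hy
      exact der_ad_eq_zero_of_pow_eq_zero hF hm) (fun x hx y hy => by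
      change PolyFun.der (T ⁅x, y⁆) F = 0
      have hT : T ⁅x, y⁆ = T x ∘ₗ T y - T y ∘ₗ T x := by
        ext z
        change ⁅j ⁅x, y⁆, z⁆ = ⁅j x, ⁅j y, z⁆⁆ - ⁅j y, ⁅j x, z⁆⁆
        rw [hj, lie_lie]
      have hx' : PolyFun.der (T x) F = 0 := hx
      have hy' : PolyFun.der (T y) F = 0 := hy
      rw [hT, PolyFun.der_comp_sub_comp, hx', hy', map_zero, map_zero, sub_zero])
  exact (show y ∈ (PolyFun.annihilator F).comap T from htop ▸ Submodule.mem_top)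

end Invariance

section Jets

variable {L : Type*} [LieRing L] [LieAlgebra ℂ L]

lemma eval_apply_of_mem_adjointInvariants {P : PolyFun L} (hP : P ∈ adjointInvariants L)
    (s : L ≃ₗ[ℂ] L) (hs : s ∈ expGroup ℂ (Set.univ : Set L)) (x : L) :
    PolyFun.eval (s x) P = PolyFun.eval x P := by
  have h := PolyFun.mem_invariants.1 hP s.toLinearMap ⟨s, hs, rfl⟩
  conv_rhs => rw [← h, PolyFun.eval_pullback]
  rfl

lemma eval_apply_of_mem_jetAdjointInvariants {n : ℕ} {F : PolyFun (Jet n ⊗[ℂ] L)}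
    (hF : F ∈ jetAdjointInvariants L n) (s : (Jet n ⊗[ℂ] L) ≃ₗ[Jet n] (Jet n ⊗[ℂ] L))
    (hs : s ∈ expGroup (Jet n) (Set.univ : Set (Jet n ⊗[ℂ] L))) (x : Jet n ⊗[ℂ] L) :
    PolyFun.eval (s x) F = PolyFun.eval x F := by
  have h := PolyFun.mem_invariants.1 hF (s.toLinearMap.restrictScalars ℂ) ⟨s, hs, rfl⟩
  conv_rhs => rw [← h, PolyFun.eval_pullback]
  rfl

/-- If `P` is annihilated by the vector fields of all elements of `L`, then its values on points of
`L` over any `ℂ`-algebra are invariant under the adjoint group. -/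
lemma evalAt_apply_of_mem_expGroup {A : Type*} [CommRing A] [Algebra ℂ A] {P : PolyFun L}
    (hP : ∀ y : L, PolyFun.der (LieAlgebra.ad ℂ L y) P = 0)
    {s : (A ⊗[ℂ] L) ≃ₗ[A] (A ⊗[ℂ] L)} (hs : s ∈ expGroup A (Set.univ : Set (A ⊗[ℂ] L)))
    (x : A ⊗[ℂ] L) : PolyFun.evalAt (s x) P = PolyFun.evalAt x P := by
  induction hs using Subgroup.closure_induction generalizing x with
  | mem s hs =>
    obtain ⟨ν, -, hs⟩ := hs
    obtain ⟨m, hm, hs'⟩ := hs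
    obtain ⟨t, rfl⟩ := TensorProduct.exists_finset ν
    rw [hs']
    refine PolyFun.evalAt_exp_eq t (fun i => i.1) (fun i => LieAlgebra.ad ℂ L i.2)
      (fun i _ => hP i.2) (fun z => ?_) hm x
    rw [LieAlgebra.ad_apply, sum_lie]
    refine Finset.sum_congr rfl fun i _ => ?_
    induction z with
    | zero => simp
    | add z z' hz hz' => simp only [map_add, lie_add, smul_add, hz, hz']
    | tmul a z => simp [TensorProduct.smul_tmul']
  | one => rfl
  | mul s s' _ _ h h' => rw [LinearEquiv.mul_apply, h, h']
  | inv s _ h =>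
    rw [← h (s⁻¹ x), ← LinearEquiv.mul_apply, mul_inv_cancel]
    rfl

/-- The coordinates of the value of a polynomial function on `A`-points are polynomial functions. -/
lemma exists_eval_eq_coord {V : Type*} [AddCommGroup V] [Module ℂ V] {A κ : Type*} [CommRing A]
    [Algebra ℂ A] [Fintype κ] (β : Module.Basis κ ℂ A) (P : PolyFun V) :
    ∃ F : κ → PolyFun (A ⊗[ℂ] V), ∀ x k,
      PolyFun.eval x (F k) = β.repr (PolyFun.evalAt x P) k := by
  induction P using SymmetricAlgebra.induction with
  | algebraMap r =>
    exact ⟨fun k => algebraMap ℂ _ (β.repr (algebraMap ℂ A r) k), fun x k => by simp⟩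
  | ι φ =>
    refine ⟨fun k => SymmetricAlgebra.ι ℂ _ (β.coord k ∘ₗ (φ.baseChange A).restrictScalars ℂ),
      fun x k => ?_⟩
    rw [PolyFun.eval_ι, PolyFun.evalAt_ι]
    rfl
  | add P Q hP hQ =>
    obtain ⟨F, hF⟩ := hP
    obtain ⟨F', hF'⟩ := hQ
    exact ⟨F + F', fun x k => by simp [hF, hF']⟩
  | mul P Q hP hQ =>
    obtain ⟨F, hF⟩ := hP
    obtain ⟨F', hF'⟩ := hQ
    refine ⟨fun k => ∑ i, ∑ j, β.repr (β i * β j) k • (F i * F' j), fun x k => ?_⟩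
    rw [map_mul]
    conv_rhs => rw [← β.sum_repr (PolyFun.evalAt x P), ← β.sum_repr (PolyFun.evalAt x Q),
      Finset.sum_mul_sum]
    simp [hF, hF', Finsupp.finsetSum_apply, mul_comm, mul_left_comm]

/-- The powers `1, t, …, tⁿ⁻¹` form a basis of `ℂ[t]/tⁿ`. -/
lemma exists_jetBasis (n : ℕ) :
    ∃ β : Module.Basis (Fin n) ℂ (Jet n), ∀ k, β k = jetT n ^ (k : ℕ) := by
  have hmk : ∀ c : Fin n → ℂ, ∑ k, c k • jetT n ^ (k : ℕ) =
      Ideal.Quotient.mk (Ideal.span {(PowerSeries.X : PowerSeries ℂ) ^ n})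
        (∑ k, c k • PowerSeries.X ^ (k : ℕ)) := by
    intro c
    rw [map_sum]
    exact Finset.sum_congr rfl fun k _ => rfl
  have hcoeff : ∀ (c : Fin n → ℂ) (i : ℕ), PowerSeries.coeff i
      (∑ k, c k • (PowerSeries.X : PowerSeries ℂ) ^ (k : ℕ)) =
        if h : i < n then c ⟨i, h⟩ else 0 := by
    intro c i
    simp only [map_sum, PowerSeries.coeff_smul, PowerSeries.coeff_X_pow, smul_eq_mul, mul_ite,
      mul_one, mul_zero]
    split_ifs with h
    · rw [Finset.sum_eq_single ⟨i, h⟩]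
      · simp
      · intro k _ hk
        rw [if_neg fun h' => hk (Fin.ext h'.symm)]
      · simp
    · exact Finset.sum_eq_zero fun k _ => if_neg (by have := k.2; lia)
  refine ⟨Module.Basis.mk (v := fun k : Fin n => jetT n ^ (k : ℕ)) ?_ ?_, fun k =>
    Module.Basis.mk_apply _ _ k⟩
  · refine Fintype.linearIndependent_iff.2 fun c hc i => ?_
    rw [hmk, Ideal.Quotient.eq_zero_iff_mem, Ideal.mem_span_singleton,
      PowerSeries.X_pow_dvd_iff] at hc
    simpa [hcoeff] using hc i i.2
  · rintro z -
    obtain ⟨q, rfl⟩ := Ideal.Quotient.mk_surjective z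
    have : Ideal.Quotient.mk (Ideal.span {(PowerSeries.X : PowerSeries ℂ) ^ n}) q =
        ∑ k : Fin n, PowerSeries.coeff (k : ℕ) q • jetT n ^ (k : ℕ) := by
      rw [hmk, Ideal.Quotient.eq, Ideal.mem_span_singleton, PowerSeries.X_pow_dvd_iff]
      intro i hi
      rw [map_sub, hcoeff, dif_pos hi, sub_self]
    rw [this]
    exact Submodule.sum_mem _ fun k _ =>
      Submodule.smul_mem _ _ (Submodule.subset_span ⟨k, rfl⟩)

instance (n : ℕ) : FiniteDimensional ℂ (Jet n) :=
  let ⟨β, _⟩ := exists_jetBasis n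
  Module.Finite.of_basis β

/-- The coefficients of an invariant polynomial function, as functions on jets, are invariant under
the adjoint group over `ℂ[t]/tⁿ`. -/
lemma exists_jet_coefficients [FiniteDimensional ℂ L] (hgen : GeneratedByNilpotents L) (n : ℕ)
    {P : PolyFun L} (hP : P ∈ adjointInvariants L) :
    ∃ F : Fin n → jetAdjointInvariants L n, ∀ x : Jet n ⊗[ℂ] L,
      PolyFun.evalAt x P =
        ∑ k, PolyFun.eval x (F k : PolyFun (Jet n ⊗[ℂ] L)) • jetT n ^ (k : ℕ) := by
  obtain ⟨β, hβ⟩ := exists_jetBasis n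
  obtain ⟨F, hF⟩ := exists_eval_eq_coord β P
  have hder : ∀ y : L, PolyFun.der (LieAlgebra.ad ℂ L y) P = 0 := fun y =>
    der_ad_eq_zero hgen (A := ℂ) (eval_apply_of_mem_adjointInvariants hP) LinearMap.id
      (fun _ _ => rfl) (fun _ h => h) y
  refine ⟨fun k => ⟨F k, PolyFun.mem_invariants.2 ?_⟩, fun x => ?_⟩
  · rintro _ ⟨s, hs, rfl⟩
    refine PolyFun.eq_of_forall_eval_eq fun x => ?_
    rw [PolyFun.eval_pullback, hF, hF]
    change β.repr (PolyFun.evalAt (s x) P) k = _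
    rw [evalAt_apply_of_mem_expGroup hder hs]
  · conv_lhs => rw [← β.sum_repr (PolyFun.evalAt x P)]
    simp only [hF, hβ]

/-- The torus generated by `ad h` contracts `z + p` to `z`, so invariant functions take the same
value at both. -/
lemma eval_one_tmul_add_eq (hgen : GeneratedByNilpotents L) {A : Type*} [CommRing A] [Algebra ℂ A]
    [FiniteDimensional ℂ (A ⊗[ℂ] L)] {F : PolyFun (A ⊗[ℂ] L)}
    (hF : ∀ s ∈ expGroup A (Set.univ : Set (A ⊗[ℂ] L)), ∀ x,
      PolyFun.eval (s x) F = PolyFun.eval x F)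
    {h p : L} (hp : ⁅h, p⁆ = -p) {z : A ⊗[ℂ] L} (hz : ⁅(1 : A) ⊗ₜ[ℂ] h, z⁆ = 0) :
    PolyFun.eval (1 ⊗ₜ p + z) F = PolyFun.eval z F := by
  have hder := der_ad_eq_zero hgen (A := A) (M := A ⊗[ℂ] L) hF (TensorProduct.mk ℂ A L 1)
    (fun x y => by simp) (fun y hy => by
      have : LieAlgebra.ad A (A ⊗[ℂ] L) ((TensorProduct.mk ℂ A L) 1 y) =
          Module.End.baseChangeHom ℂ A L (LieAlgebra.ad ℂ L y) := by
        ext x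
        change ⁅(1 : A) ⊗ₜ[ℂ] y, (1 : A) ⊗ₜ[ℂ] x⁆ = (1 : A) ⊗ₜ[ℂ] ⁅y, x⁆
        simp
      rw [this]
      exact hy.map _) h
  refine PolyFun.eval_add_eq_of_der_eq_zero hder hz ?_
  change ⁅(1 : A) ⊗ₜ[ℂ] h, (1 : A) ⊗ₜ[ℂ] p⁆ = _
  simp [hp, TensorProduct.tmul_neg]

lemma toJetAdjointQuotient_add_eq [FiniteDimensional ℂ L] (hgen : GeneratedByNilpotents L) (n : ℕ)
    {h p : L} (hp : ⁅h, p⁆ = -p) {z : Jet n ⊗[ℂ] L} (hz : ⁅(1 : Jet n) ⊗ₜ[ℂ] h, z⁆ = 0) :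
    toJetAdjointQuotient n (1 ⊗ₜ p + z) = toJetAdjointQuotient n z := by
  refine AlgHom.ext fun F => ?_
  exact eval_one_tmul_add_eq hgen (eval_apply_of_mem_jetAdjointInvariants F.2) hp hz

end Jets

/-! ### The half-sum of the positive roots -/

section RootPairings

variable {ι R M N : Type*} [CommRing R] [CharZero R] [AddCommGroup M]
  [Module R M] [AddCommGroup N] [Module R N] {P : RootPairing ι R M N} [P.IsCrystallographic]
  (b : P.Base)

lemma height_reflectionPerm (i j : ι) :
    b.height (P.reflectionPerm j i) = b.height i - P.pairingIn ℤ i j * b.height j := by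
  have : P.root (P.reflectionPerm j i) = P.root i + (-P.pairingIn ℤ i j) • P.root j := by
    rw [RootPairing.root_reflectionPerm, neg_smul, RootPairing.reflection_apply_root' ℤ,
      sub_eq_add_neg]
  rw [b.height_add_zsmul this]
  ring

variable [Fintype ι]

open scoped Classical in
/-- In the sum of the pairings of the positive roots with a coroot, the positive roots that stay
positive under the corresponding reflection cancel. -/
lemma sum_pairingIn_isPos (j : ι) :
    ∑ i with b.IsPos i, P.pairingIn ℤ i j =
      ∑ i with b.IsPos i ∧ ¬ b.IsPos (P.reflectionPerm j i), P.pairingIn ℤ i j := by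
  rw [← Finset.sum_filter_add_sum_filter_not _ fun i => b.IsPos (P.reflectionPerm j i)]
  simp only [Finset.filter_filter]
  rw [add_eq_right]
  refine Finset.sum_involution (fun i _ => P.reflectionPerm j i) (fun i _ => ?_)
    (fun i _ hi h => ?_) (fun i hi => ?_) (fun i _ => ?_)
  · have : P.pairingIn ℤ (P.reflectionPerm j i) j = -P.pairingIn ℤ i j := by
      rw [← P.pairingIn_reflectionPerm, RootPairing.pairingIn_reflectionPerm_self_right]
    rw [this, add_neg_cancel]
  · have : P.pairingIn ℤ (P.reflectionPerm j i) j = -P.pairingIn ℤ i j := by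
      rw [← P.pairingIn_reflectionPerm, RootPairing.pairingIn_reflectionPerm_self_right]
    rw [h] at this
    lia
  · simp only [Finset.mem_filter, Finset.mem_univ, true_and] at hi ⊢
    simpa using hi.symm
  · simp

open scoped Classical in
lemma sum_pairingIn_isPos_pos {j : ι} (hj : b.IsPos j) :
    0 < ∑ i with b.IsPos i, P.pairingIn ℤ i j := by
  rw [sum_pairingIn_isPos]
  refine Finset.sum_pos (fun i hi => ?_) ⟨j, ?_⟩
  · simp only [Finset.mem_filter, Finset.mem_univ, true_and, RootPairing.Base.isPos_iff,
      height_reflectionPerm] at hi hj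
    by_contra! h
    nlinarith
  · rw [RootPairing.Base.isPos_iff] at hj
    simp only [Finset.mem_filter, Finset.mem_univ, true_and, RootPairing.Base.isPos_iff,
      height_reflectionPerm, RootPairing.pairingIn_same]
    lia

open scoped Classical in
lemma sum_pairingIn_isPos_of_mem_support [IsDomain R] [P.IsReduced] {j : ι} (hj : j ∈ b.support) :
    ∑ i with b.IsPos i, P.pairingIn ℤ i j = 2 := by
  rw [sum_pairingIn_isPos, Finset.sum_eq_single j]
  · simp
  · intro i hi hij
    simp only [Finset.mem_filter, Finset.mem_univ, true_and] at hi
    exact absurd (hi.1.reflectionPerm hj hij) hi.2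
  · intro h
    refine absurd ?_ h
    have hj' := RootPairing.Base.isPos_of_mem_support hj
    rw [RootPairing.Base.isPos_iff] at hj'
    simp only [Finset.mem_filter, Finset.mem_univ, true_and, RootPairing.Base.isPos_iff,
      height_reflectionPerm, RootPairing.pairingIn_same]
    lia

end RootPairings

section Rho

open LieAlgebra LieAlgebra.IsKilling

variable {g : Type*} [LieRing g] [LieAlgebra ℂ g] [FiniteDimensional ℂ g] [IsKilling ℂ g]
  {H : LieSubalgebra ℂ g} [H.IsCartanSubalgebra] (b : (rootSystem H).Base)

open scoped Classical in
lemma two_mul_rho_coroot (α : H.root) :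
    2 * rho b ((rootSystem H).coroot α) =
      ((∑ β with b.IsPos β, (rootSystem H).pairingIn ℤ β α : ℤ) : ℂ) := by
  rw [rho, LinearMap.smul_apply, LinearMap.sum_apply]
  push_cast
  rw [smul_eq_mul, ← mul_assoc]
  norm_num
  refine Finset.sum_congr rfl fun β _ => ?_
  have := (rootSystem H).algebraMap_pairingIn ℤ β α
  simpa using this.symm

lemma rho_coroot_of_mem_support {i : H.root} (hi : i ∈ b.support) :
    rho b ((rootSystem H).coroot i) = 1 := by
  have := two_mul_rho_coroot b i
  rw [sum_pairingIn_isPos_of_mem_support b hi] at this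
  push_cast at this
  linear_combination this / 2

/-- The pairings of `ρ` with coroots are integers. -/
lemma exists_rho_coroot_eq (α : H.root) : ∃ k : ℤ, rho b ((rootSystem H).coroot α) = k := by
  have h := b.coroot_mem_span_int α
  refine Submodule.span_induction (p := fun y _ => ∃ k : ℤ, rho b y = k) ?_ ⟨0, by simp⟩ ?_ ?_ h
  · rintro _ ⟨i, hi, rfl⟩
    exact ⟨1, by rw [rho_coroot_of_mem_support b hi]; simp⟩
  · rintro x y - - ⟨k, hk⟩ ⟨l, hl⟩
    exact ⟨k + l, by rw [map_add, hk, hl]; push_cast; rfl⟩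
  · rintro a x - ⟨k, hk⟩
    exact ⟨a * k, by rw [map_zsmul, hk]; simp⟩

lemma exists_rho_coroot_eq_of_isPos {α : H.root} (hα : b.IsPos α) :
    ∃ k : ℤ, 1 ≤ k ∧ rho b ((rootSystem H).coroot α) = k := by
  obtain ⟨k, hk⟩ := exists_rho_coroot_eq b α
  refine ⟨k, ?_, hk⟩
  have h := two_mul_rho_coroot b α
  have h' := sum_pairingIn_isPos_pos b hα
  rw [hk] at h
  norm_cast at h
  lia

/-- `ρ` is a combination of the simple roots. -/
lemma exists_rho_eq_sum : 
    ∃ c : b.support → ℂ, rho b = ∑ i : b.support, c i • (rootSystem H).root i := by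
  have h : rho b ∈ Submodule.span ℂ ((rootSystem H).root '' b.support) := by
    rw [b.span_root_support]
    exact Submodule.smul_mem _ _ (Submodule.sum_mem _ fun i _ => Submodule.subset_span ⟨i, rfl⟩)
  obtain ⟨c, hc⟩ := (Submodule.mem_span_image_finset_iff_exists_fun ℂ).1 h
  exact ⟨c, hc.symm⟩

end Rho

/-! ### Semisimple Lie algebras: gradings, generators, reflections -/

lemma IsExpAd.apply_eq_of_lie_eq_zero {M : Type*} [LieRing M] [LieAlgebra ℂ M] {ν : M}
    {s : M ≃ₗ[ℂ] M} (hs : IsExpAd ℂ ν s) {x : M} (hx : ⁅ν, ⁅ν, ⁅ν, x⁆⁆⁆ = 0) :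
    s x = x + ⁅ν, x⁆ + (2⁻¹ : ℂ) • ⁅ν, ⁅ν, x⁆⁆ := by
  obtain ⟨m, hm, -⟩ := id hs
  rw [hs.apply_eq (m := m + 3) (by rw [pow_add, hm, zero_mul]),
    ← Finset.sum_subset (Finset.range_mono (show 3 ≤ m + 3 by lia))]
  · simp [Finset.sum_range_succ, pow_two]
  · intro k _ hk
    obtain ⟨j, rfl⟩ := Nat.exists_eq_add_of_le (show 3 ≤ k by simpa using hk)
    rw [add_comm, pow_add, Module.End.mul_apply]
    simp [pow_succ, hx]

section Grading

variable {L : Type*} [LieRing L] [LieAlgebra ℂ L] [FiniteDimensional ℂ L]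

open Module.End in
lemma nonempty_adGrading {h : L}
    (htop : ⨆ k : ℤ, eigenspace (LieAlgebra.ad ℂ L h) (k : ℂ) = ⊤) : Nonempty (AdGrading h) := by
  classical
  have hind : iSupIndep fun k : ℤ => eigenspace (LieAlgebra.ad ℂ L h) (k : ℂ) :=
    (eigenspaces_iSupIndep _).comp Int.cast_injective
  have hint := (DirectSum.isInternal_submodule_iff_iSupIndep_and_iSup_eq_top _).2 ⟨hind, htop⟩
  let dec := hint.chooseDecomposition
  let pr : ℤ → L →ₗ[ℂ] L := fun d => (eigenspace (LieAlgebra.ad ℂ L h) (d : ℂ)).subtype ∘ₗ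
    DirectSum.component ℂ ℤ _ d ∘ₗ
      (DirectSum.decomposeLinearEquiv fun k : ℤ =>
        eigenspace (LieAlgebra.ad ℂ L h) (k : ℂ)).toLinearMap
  have hlie : ∀ d x, ⁅h, pr d x⁆ = (d : ℂ) • pr d x := fun d x =>
    mem_eigenspace_iff.1
      (show pr d x ∈ eigenspace (LieAlgebra.ad ℂ L h) (d : ℂ) from Subtype.prop _)
  have hof : ∀ (k : ℤ) (x : L), ⁅h, x⁆ = (k : ℂ) • x → ∀ d, pr d x = if d = k then x else 0 := by
    intro k x hx d
    have hx' : x ∈ eigenspace (LieAlgebra.ad ℂ L h) (k : ℂ) := mem_eigenspace_iff.2 hx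
    have := DirectSum.decompose_of_mem (fun k : ℤ => eigenspace (LieAlgebra.ad ℂ L h) (k : ℂ)) hx'
    change ((DirectSum.decompose (fun k : ℤ => eigenspace (LieAlgebra.ad ℂ L h) (k : ℂ)) x d :
      eigenspace (LieAlgebra.ad ℂ L h) (d : ℂ)) : L) = _
    rw [this, DirectSum.coe_of_apply]
    by_cases hdk : d = k
    · rw [if_pos hdk, if_pos hdk.symm]
    · rw [if_neg hdk, if_neg (Ne.symm hdk)]
      rfl
  have hfin := WellFoundedGT.finite_ne_bot_of_iSupIndep hind
  obtain ⟨B, hB⟩ : ∃ B : ℕ, ∀ d ∉ Finset.Icc (-B : ℤ) B,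
      eigenspace (LieAlgebra.ad ℂ L h) (d : ℂ) = ⊥ := by
    refine ⟨hfin.toFinset.sup Int.natAbs, fun d hd => ?_⟩
    by_contra hne
    refine hd ?_
    have := Finset.le_sup (f := Int.natAbs) (hfin.mem_toFinset.2 hne)
    rw [Finset.mem_Icc]
    lia
  have hzero : ∀ d ∉ Finset.Icc (-B : ℤ) B, pr d = 0 := by
    intro d hd
    ext x
    exact (Submodule.eq_bot_iff _).1 (hB d hd) _ (mem_eigenspace_iff.2 (hlie d x))
  refine ⟨⟨pr, B, hzero, fun x => ?_, hlie, hof⟩⟩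
  have hx : x ∈ ⨆ k : ℤ, eigenspace (LieAlgebra.ad ℂ L h) (k : ℂ) := htop ▸ Submodule.mem_top
  induction hx using Submodule.iSup_induction' with
  | mem k x hx =>
    rw [Finset.sum_congr rfl fun d _ => hof k x (mem_eigenspace_iff.1 hx) d, Finset.sum_ite_eq']
    split_ifs with hk
    · rfl
    · rw [hB k hk] at hx
      exact ((Submodule.mem_bot ℂ).1 hx).symm
  | zero => simp
  | add x y _ _ hx hy => simp only [map_add, Finset.sum_add_distrib, hx, hy]

open LieAlgebra LieModule in
lemma lie_eq_zero_of_mem_rootSpace {H : LieSubalgebra ℂ L} [H.IsCartanSubalgebra]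
    {α β : H → ℂ} {x y : L} (hx : x ∈ rootSpace H α)
    (hy : y ∈ rootSpace H β) (h0 : α + β ≠ 0)
    (h : α + β ∉ Set.range fun γ : H.root => (γ.1 : H → ℂ)) :
    ⁅x, y⁆ = 0 := by
  by_contra hne
  have hmem := lie_mem_genWeightSpace_of_mem_genWeightSpace hx hy
  refine h ⟨⟨⟨α + β, fun hbot => hne ?_⟩, ?_⟩, rfl⟩
  · rw [hbot] at hmem
    exact hmem
  · simpa [Weight.IsNonZero, Weight.IsZero] using h0

open LieAlgebra LieModule in
/-- The root space decomposition. -/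
lemma eq_top_of_rootSpace_le {H : LieSubalgebra ℂ L} [H.IsCartanSubalgebra] {S : Submodule ℂ L} 
    (hH : H.toSubmodule ≤ S)
    (hS : ∀ α : H.root, (rootSpace H (α.1 : H → ℂ)).toSubmodule ≤ S) : S = ⊤ := by
  have h := congrArg LieSubmodule.toSubmodule (iSup_genWeightSpace_eq_top' ℂ H L)
  rw [LieSubmodule.iSup_toSubmodule, LieSubmodule.top_toSubmodule] at h
  rw [eq_top_iff, ← h]
  refine iSup_le fun α => ?_
  by_cases hα : α.IsZero
  · rw [hα.eq]
    refine le_trans (le_of_eq ?_) hH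
    exact congrArg LieSubmodule.toSubmodule (rootSpace_zero_eq ℂ L H)
  · exact hS ⟨α, by simpa using hα⟩

end Grading

section Killing

open LieAlgebra LieAlgebra.IsKilling LieModule

variable {L : Type*} [LieRing L] [LieAlgebra ℂ L] [FiniteDimensional ℂ L] [IsKilling ℂ L]
  {H : LieSubalgebra ℂ L} [H.IsCartanSubalgebra]

lemma lie_of_mem_rootSpace {α : H → ℂ} {x : L} (hx : x ∈ rootSpace H α) {h : L} (hh : h ∈ H) :
    ⁅h, x⁆ = α ⟨h, hh⟩ • x :=
  lie_eq_smul_of_mem_rootSpace hx ⟨h, hh⟩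

lemma lie_eq_zero_of_mem_cartan {x y : L} (hx : x ∈ H) (hy : y ∈ H) : ⁅x, y⁆ = 0 := by
  have := lie_of_mem_rootSpace (toLieSubmodule_le_rootSpace_zero ℂ L H hy) hx
  simpa using this

lemma exists_lie_eq_coroot {α : H.root} {f : L} (hf : f ∈ rootSpace H (-(α.1 : H → ℂ)))
    (hf0 : f ≠ 0) : ∃ e ∈ rootSpace H (α.1 : H → ℂ), ⁅e, f⁆ = (coroot α.1 : L) := by
  have hα := LieSubalgebra.isNonZero_coe_root α
  obtain ⟨h, e, f', ht, he, hf'⟩ := exists_isSl2Triple_of_weight_isNonZero hα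
  have h1 := finrank_rootSpace_eq_one (-α.1) hα.neg
  rw [Weight.coe_neg] at h1
  obtain ⟨c, hc⟩ := (finrank_eq_one_iff_of_nonzero' (⟨f, hf⟩ : rootSpace H (-(α.1 : H → ℂ)))
    (by simpa using hf0)).1 h1 ⟨f', hf'⟩
  replace hc : c • f = f' := congrArg Subtype.val hc
  refine ⟨c • e, Submodule.smul_mem _ _ he, ?_⟩
  rw [smul_lie, ← lie_smul, hc, ht.lie_e_f, ht.h_eq_coroot hα he hf']

/-- The root vectors are nilpotent, and their brackets span the Cartan subalgebra. -/
lemma generatedByNilpotents (H : LieSubalgebra ℂ L) [H.IsCartanSubalgebra] :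
     GeneratedByNilpotents L := by
  intro S hS hlie
  have hroot : ∀ α : Weight ℂ H L, α.IsNonZero → ∀ x ∈ rootSpace H (α : H → ℂ), x ∈ S :=
    fun α hα x hx => hS x (isNilpotent_ad_of_mem_rootSpace H hα hx)
  refine eq_top_of_rootSpace_le (H := H) (fun x hx => ?_)
    fun α x hx => hroot α (LieSubalgebra.isNonZero_coe_root α) x hx
  have hspan : (⟨x, hx⟩ : H) ∈ Submodule.span ℂ (Set.range (rootSystem H).coroot) := by
    rw [RootPairing.IsRootSystem.span_coroot_eq_top]
    trivial
  have hle : Submodule.span ℂ (Set.range (rootSystem H).coroot) ≤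
      S.comap H.toSubmodule.subtype := by
    rw [Submodule.span_le]
    rintro _ ⟨α, rfl⟩
    have hα := LieSubalgebra.isNonZero_coe_root α
    obtain ⟨h, e, f, ht, he, hf⟩ := exists_isSl2Triple_of_weight_isNonZero hα
    change (coroot α.1 : L) ∈ S
    rw [← ht.h_eq_coroot hα he hf, ← ht.lie_e_f]
    exact hlie _ (hroot _ hα _ he) _ (hroot (-α.1) hα.neg _ (by simpa using hf))
  exact hle hspan

lemma nonempty_adGrading_of_integral {h : L} (hh : h ∈ H)
    (hint : ∀ α : H.root, ∃ k : ℤ, α.1 ⟨h, hh⟩ = k) : Nonempty (AdGrading h) := by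
  refine nonempty_adGrading (eq_top_of_rootSpace_le (H := H) (fun x hx => ?_) fun α x hx => ?_)
  · refine Submodule.mem_iSup_of_mem 0 (Module.End.mem_eigenspace_iff.2 ?_)
    rw [ad_apply, lie_eq_zero_of_mem_cartan hh hx]
    simp
  · obtain ⟨k, hk⟩ := hint α
    refine Submodule.mem_iSup_of_mem k (Module.End.mem_eigenspace_iff.2 ?_)
    rw [ad_apply, lie_of_mem_rootSpace hx hh, hk]

/-- The reflections in the roots are induced by elements of the adjoint group. -/
lemma exists_mem_expGroup_reflection (α : H.root) :
    ∃ s ∈ expGroup ℂ (Set.univ : Set L), ∀ x : H, s (x : L) = x - α.1 x • (coroot α.1 : L) := by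
  have hα := LieSubalgebra.isNonZero_coe_root α
  obtain ⟨h, e, f, ht, he, hf⟩ := exists_isSl2Triple_of_weight_isNonZero hα
  have hh := ht.h_eq_coroot hα he hf
  obtain ⟨m, hm⟩ := isNilpotent_ad_of_mem_rootSpace H hα he
  obtain ⟨m', hm'⟩ := isNilpotent_ad_of_mem_rootSpace H hα.neg (x := -f)
    (by simpa using hf)
  obtain ⟨s, hs⟩ := exists_isExpAd hm
  obtain ⟨s', hs'⟩ := exists_isExpAd hm'
  have hmem : ∀ {ν s}, IsExpAd ℂ ν s → s ∈ expGroup ℂ (Set.univ : Set L) := fun h =>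
    Subgroup.subset_closure ⟨_, Set.mem_univ _, h⟩
  refine ⟨s * s' * s, mul_mem (mul_mem (hmem hs) (hmem hs')) (hmem hs), fun x => ?_⟩
  have hef := ht.lie_e_f
  have hfe : ⁅f, e⁆ = -h := by rw [← lie_skew, hef]
  have hhe := ht.lie_h_e_smul ℂ
  have heh : ⁅e, h⁆ = -((2 : ℂ) • e) := by rw [← lie_skew, hhe]
  have hhf := ht.lie_lie_smul_f ℂ
  have hfh : ⁅f, h⁆ = (2 : ℂ) • f := by rw [← lie_skew, hhf, neg_neg]
  have hxe : ⁅e, (x : L)⁆ = -(α.1 x • e) := by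
    rw [← lie_skew, lie_of_mem_rootSpace he x.2]
  have hxf : ⁅f, (x : L)⁆ = α.1 x • f := by
    rw [← lie_skew, lie_of_mem_rootSpace hf x.2]
    simp
  have h1 : s (x : L) = x - α.1 x • e := by
    rw [hs.apply_eq_of_lie_eq_zero] <;> simp [hxe, sub_eq_add_neg]
  have h2 : s' (x : L) = x - α.1 x • f := by
    rw [hs'.apply_eq_of_lie_eq_zero] <;> simp [hxf, sub_eq_add_neg]
  have h3 : s' e = e + h - f := by
    rw [hs'.apply_eq_of_lie_eq_zero] <;> simp [hfe, hfh, sub_eq_add_neg]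
  have h4 : s e = e := by
    rw [hs.apply_eq_of_lie_eq_zero] <;> simp
  have h5 : s h = h - (2 : ℂ) • e := by
    rw [hs.apply_eq_of_lie_eq_zero] <;> simp [heh, sub_eq_add_neg]
  rw [LinearEquiv.mul_apply, LinearEquiv.mul_apply, h1, map_sub, map_smul, h2, h3, ← hh]
  rw [show (x : L) - α.1 x • f - α.1 x • (e + h - f) = x - α.1 x • e - α.1 x • h by module,
    map_sub, map_sub, map_smul, map_smul, h1, h4, h5]
  module

end Killing

/-! ### The principal grading of the dual Lie algebra -/

section DualLie

open LieAlgebra LieAlgebra.IsKilling LieModule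

variable {g : Type*} [LieRing g] [LieAlgebra ℂ g] [FiniteDimensional ℂ g] [IsKilling ℂ g]
  {H : LieSubalgebra ℂ g} [H.IsCartanSubalgebra]
  {g' : Type*} [LieRing g'] [LieAlgebra ℂ g'] [FiniteDimensional ℂ g'] [IsKilling ℂ g']
  {H' : LieSubalgebra ℂ g'} [H'.IsCartanSubalgebra]
  (b : (rootSystem H).Base) (e : LanglandsDual H H') {f : b.support → g'}

lemma dualCartan_mem (x : Module.Dual ℂ H) : dualCartan e x ∈ H' :=
  (RootPairing.Equiv.coweightEquiv _ _ e x).2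

lemma root_dualCartan (α : H'.root) (x : Module.Dual ℂ H) :
    α.1 ⟨dualCartan e x, dualCartan_mem e x⟩ = x ((rootSystem H).coroot (e.indexEquiv α)) := by
  have h := LinearMap.congr_fun (RootPairing.Hom.weight_coweight_transpose_apply _ _ x e.toHom)
    ((rootSystem H').root α)
  rw [LinearMap.dualMap_apply, RootPairing.Hom.root_weightMap_apply] at h
  exact h.symm

lemma dualCartan_root (α : H.root) :
    dualCartan e ((rootSystem H).root α) = (coroot (e.indexEquiv.symm α).1 : g') :=
  congrArg Subtype.val (RootPairing.Hom.coroot_coweightMap_apply _ _ α e.toHom)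

/-- Restriction to the Cartan subalgebra takes adjoint invariants to Weyl group invariants. -/
lemma pullback_dualCartan_mem_weylInvariants {P : PolyFun g'} (hP : P ∈ adjointInvariants g') :
    PolyFun.pullback (dualCartan e) P ∈ weylInvariants H := by
  refine PolyFun.mem_invariants.2 ?_
  rintro _ ⟨α, rfl⟩
  obtain ⟨s, hs, h⟩ := exists_mem_expGroup_reflection (e.indexEquiv.symm α)
  refine PolyFun.eq_of_forall_eval_eq fun x => ?_
  rw [PolyFun.eval_pullback, PolyFun.eval_pullback, PolyFun.eval_pullback,
    ← eval_apply_of_mem_adjointInvariants hP s hs (dualCartan e x),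
    h ⟨dualCartan e x, dualCartan_mem e x⟩, root_dualCartan, e.indexEquiv.apply_symm_apply,
    ← dualCartan_root, ← map_smul, ← map_sub]
  rfl

lemma exists_root_dualCartan_rho_eq (α : H'.root) :
    ∃ k : ℤ, α.1 ⟨dualCartan e (rho b), dualCartan_mem e _⟩ = k := by
  rw [root_dualCartan]
  exact exists_rho_coroot_eq b _

lemma nonempty_adGrading_dualCartan_rho : Nonempty (AdGrading (dualCartan e (rho b))) :=
  nonempty_adGrading_of_integral (dualCartan_mem e _) (exists_root_dualCartan_rho_eq b e)

variable {b e}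

lemma lie_dualCartan_rho_of_isNegSimpleGenerators (hf : IsNegSimpleGenerators b e f)
    (i : b.support) : ⁅dualCartan e (rho b), f i⁆ = -f i := by
  have h := lie_of_mem_rootSpace (hf i).2 (dualCartan_mem e (rho b))
  rw [Pi.neg_apply, root_dualCartan, e.indexEquiv.apply_symm_apply,
    rho_coroot_of_mem_support b i.2] at h
  rw [h, neg_one_smul]

lemma lie_dualCartan_rho_pMinusOne (hf : IsNegSimpleGenerators b e f) :
    ⁅dualCartan e (rho b), pMinusOne b f⁆ = -pMinusOne b f := by
  simp only [pMinusOne, lie_sum, lie_dualCartan_rho_of_isNegSimpleGenerators hf,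
    Finset.sum_neg_distrib]

variable (e) in
lemma AdGrading.dualNil_le (G : AdGrading (dualCartan e (rho b))) (A : Type*) [CommRing A]
    [Algebra ℂ A] : (dualNil b e).baseChange A ≤ G.filt A 1 := by
  rw [Submodule.baseChange_eq_span, Submodule.span_le]
  rintro _ ⟨x, hx, rfl⟩
  have hle : dualNil b e ≤ ((G.filt A 1).restrictScalars ℂ).comap (TensorProduct.mk ℂ A g' 1) := by
    refine iSup_le fun α x hx => ?_
    have h := lie_of_mem_rootSpace hx (dualCartan_mem e (rho b))
    obtain ⟨k, hk, hk'⟩ := exists_rho_coroot_eq_of_isPos b α.2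
    rw [root_dualCartan, hk'] at h
    exact G.filt_anti hk (G.tmul_mem_filt h 1)
  exact hle hx

variable (e) in
lemma AdGrading.dualBorel_le (G : AdGrading (dualCartan e (rho b))) (A : Type*) [CommRing A]
    [Algebra ℂ A] : (dualBorel b e).baseChange A ≤ G.filt A 0 := by
  rw [Submodule.baseChange_eq_span, Submodule.span_le]
  rintro _ ⟨x, hx, rfl⟩
  have hle : dualBorel b e ≤
      ((G.filt A 0).restrictScalars ℂ).comap (TensorProduct.mk ℂ A g' 1) := by
    refine sup_le (fun x hx => ?_) fun x hx => ?_
    · refine G.tmul_mem_filt (k := 0) ?_ 1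
      rw [lie_eq_zero_of_mem_cartan (dualCartan_mem e _) hx]
      simp
    · exact G.filt_anti (by decide)
        (G.dualNil_le e A (Submodule.tmul_mem_baseChange_of_mem 1 hx))
  exact hle hx

/-- `p₋₁` belongs to a principal `𝔰𝔩₂`-triple whose semisimple element is `2ρ`. -/
lemma exists_lie_pMinusOne_eq (hf : IsNegSimpleGenerators b e f) :
    ∃ x : g', ⁅dualCartan e (rho b), x⁆ = x ∧
      ⁅x, pMinusOne b f⁆ = (2 : ℂ) • dualCartan e (rho b) := by
  obtain ⟨c, hc⟩ := exists_rho_eq_sum b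
  have hE : ∀ i : b.support, ∃ x ∈ rootSpace H' ((e.indexEquiv.symm i.1).1 : H' → ℂ),
      ⁅x, f i⁆ = (coroot (e.indexEquiv.symm i.1).1 : g') := fun i =>
    exists_lie_eq_coroot (hf i).2 (hf i).1
  choose x hx hxf using hE
  have hij : ∀ i j, i ≠ j → ⁅x i, f j⁆ = 0 := by
    intro i j hne
    have hne' : e.indexEquiv.symm i.1 ≠ e.indexEquiv.symm j.1 := fun h =>
      hne (Subtype.ext (e.indexEquiv.symm.injective h))
    refine lie_eq_zero_of_mem_rootSpace (hx i) (hf j).2 (fun h => hne' ?_) ?_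
    · rw [← sub_eq_add_neg, sub_eq_zero] at h
      exact Subtype.ext (DFunLike.coe_injective h)
    · rintro ⟨γ, hγ⟩
      refine b.sub_notMem_range_coroot i.2 j.2 ⟨e.indexEquiv γ, ?_⟩
      have h1 : (rootSystem H').root γ = (rootSystem H').root (e.indexEquiv.symm i.1) -
          (rootSystem H').root (e.indexEquiv.symm j.1) := by
        ext y
        have := congrFun hγ y
        simpa [sub_eq_add_neg] using this
      have h2 := congrArg e.toHom.weightMap h1
      rw [map_sub, RootPairing.Hom.root_weightMap_apply, RootPairing.Hom.root_weightMap_apply,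
        RootPairing.Hom.root_weightMap_apply, e.indexEquiv.apply_symm_apply,
        e.indexEquiv.apply_symm_apply] at h2
      exact h2
  refine ⟨∑ i, (2 * c i) • x i, ?_, ?_⟩
  · rw [lie_sum]
    refine Finset.sum_congr rfl fun i _ => ?_
    have h := lie_of_mem_rootSpace (hx i) (dualCartan_mem e (rho b))
    rw [root_dualCartan, e.indexEquiv.apply_symm_apply, rho_coroot_of_mem_support b i.2,
      one_smul] at h
    rw [lie_smul, h]
  · conv_rhs => rw [hc, map_sum, Finset.smul_sum]
    rw [pMinusOne, sum_lie]
    refine Finset.sum_congr rfl fun i _ => ?_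
    rw [lie_sum, Finset.sum_eq_single i (fun j _ hj => by rw [smul_lie, hij i j hj.symm, smul_zero])
      (by simp), smul_lie, hxf, map_smul, dualCartan_root, smul_smul]

/-- A lowest weight vector of the principal `𝔰𝔩₂` cannot have positive weight. -/
lemma eq_zero_of_lie_pMinusOne_eq_zero (hf : IsNegSimpleGenerators b e f) {k : ℤ} (hk : 1 ≤ k)
    {z : g'} (hz : ⁅dualCartan e (rho b), z⁆ = (k : ℂ) • z) (hzp : ⁅z, pMinusOne b f⁆ = 0) :
    z = 0 := by
  by_contra hne
  obtain ⟨x, hx, hxp⟩ := exists_lie_pMinusOne_eq hf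
  have ht : IsSl2Triple ((2 : ℂ) • dualCartan e (rho b)) x (pMinusOne b f) := by
    refine ⟨fun h => hne ?_, hxp, ?_, ?_⟩
    · rw [smul_eq_zero_iff_right two_ne_zero] at h
      rw [h, zero_lie, eq_comm, smul_eq_zero_iff_right] at hz
      · exact hz
      · exact_mod_cast (by lia : k ≠ 0)
    · rw [smul_lie, hx, two_smul, two_nsmul]
    · rw [smul_lie, lie_dualCartan_rho_pMinusOne hf, smul_neg, two_smul, two_nsmul]
  have hprim : ht.symm.HasPrimitiveVectorWith z ((-(2 * k) : ℤ) : ℂ) := by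
    refine ⟨hne, ?_, ?_⟩
    · rw [neg_lie, smul_lie, hz, smul_smul, ← neg_smul]
      push_cast
      rfl
    · rw [← lie_skew, hzp, neg_zero]
  obtain ⟨m, hm⟩ := hprim.exists_nat
  have : -(2 * k) = (m : ℤ) := by exact_mod_cast hm
  lia

end DualLie

/-! ### The action of the cocharacter of a grading on Laurent series -/

section Cocharacter

variable {L : Type*} [LieRing L] [LieAlgebra ℂ L] {h p : L}

namespace AdGrading

variable (G : AdGrading h)

/-- The endomorphism `t ^ (m d)` on the component of degree `d`. -/
def cocharHom (m : ℤ) : Laurent ⊗[ℂ] L →ₗ[Laurent] Laurent ⊗[ℂ] L :=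
  ∑ d ∈ Finset.Icc (-G.bound : ℤ) G.bound, tPow (m * d) • G.comp Laurent d

lemma cocharHom_tmul (m : ℤ) {k : ℤ} {x : L} (hx : ⁅h, x⁆ = (k : ℂ) • x) (c : Laurent) :
    G.cocharHom m (c ⊗ₜ x) = (tPow (m * k) * c) ⊗ₜ x := by
  conv_rhs => rw [← smul_eq_mul, ← TensorProduct.smul_tmul', ← G.sum_comp (c ⊗ₜ[ℂ] x),
    Finset.smul_sum]
  rw [cocharHom, LinearMap.sum_apply]
  refine Finset.sum_congr rfl fun d _ => ?_
  rw [LinearMap.smul_apply, G.comp_one_tmul_of_lie hx]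
  split_ifs with hd
  · rw [hd]
  · rw [smul_zero, smul_zero]

/-- Additive statements may be checked on the multiples of eigenvectors. -/
lemma induction_eigen {L : Type*} [LieRing L] [LieAlgebra ℂ L] {h : L} (G : AdGrading h)
    {A : Type*} [CommRing A] [Algebra ℂ A] {motive : A ⊗[ℂ] L → Prop}
    (add : ∀ x y, motive x → motive y → motive (x + y)) (zero : motive 0)
    (tmul : ∀ (k : ℤ) (x : L), ⁅h, x⁆ = (k : ℂ) • x → ∀ c : A, motive (c ⊗ₜ x))
    (z : A ⊗[ℂ] L) : motive z := by
  induction z with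
  | zero => exact zero
  | add x y hx hy => exact add x y hx hy
  | tmul c x =>
    rw [← G.sum_proj x, TensorProduct.tmul_sum]
    exact Finset.sum_induction _ motive add zero fun d _ => tmul d _ (G.lie_proj d x) c

lemma cocharHom_cocharHom_neg (m m' : ℤ) (hm : m + m' = 0) (z : Laurent ⊗[ℂ] L) :
    G.cocharHom m (G.cocharHom m' z) = z := by
  induction z using G.induction_eigen with
  | add x y hx hy => rw [map_add, map_add, hx, hy]
  | zero => rw [map_zero, map_zero]
  | tmul k x hx c =>
    rw [G.cocharHom_tmul m' hx, G.cocharHom_tmul m hx, ← mul_assoc, Laurent.tPow_mul_tPow,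
      ← add_mul, hm, zero_mul, Laurent.tPow_zero, one_mul]

/-- The action of `ρ(t ^ m)`. -/
def cochar (m : ℤ) : (Laurent ⊗[ℂ] L) ≃ₗ[Laurent] (Laurent ⊗[ℂ] L) :=
  { G.cocharHom m with
    invFun := G.cocharHom (-m)
    left_inv := G.cocharHom_cocharHom_neg _ _ (by lia)
    right_inv := G.cocharHom_cocharHom_neg _ _ (by lia) }

lemma isRhoAction_cochar (m : ℤ) : IsRhoAction h m (G.cochar m) :=
  fun _ _ hx c => G.cocharHom_tmul m hx c

end AdGrading

namespace IsRhoAction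

variable {m : ℤ} {σ : (Laurent ⊗[ℂ] L) ≃ₗ[Laurent] (Laurent ⊗[ℂ] L)}

lemma inv (hσ : IsRhoAction h m σ) : IsRhoAction h (-m) σ⁻¹ := by
  intro k x hx c
  apply σ.injective
  rw [hσ k x hx, ← LinearEquiv.mul_apply, mul_inv_cancel, ← mul_assoc, Laurent.tPow_mul_tPow,
    ← add_mul, add_neg_cancel, zero_mul, Laurent.tPow_zero, one_mul]
  rfl

lemma map_lie (G : AdGrading h) (hσ : IsRhoAction h m σ) (x y : Laurent ⊗[ℂ] L) :
    σ ⁅x, y⁆ = ⁅σ x, σ y⁆ := by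
  induction x using G.induction_eigen with
  | add x x' hx hx' => rw [add_lie, map_add, map_add, add_lie, hx, hx']
  | zero => rw [zero_lie, map_zero, zero_lie]
  | tmul k x hx c =>
    induction y using G.induction_eigen with
    | add y y' hy hy' => rw [lie_add, map_add, map_add, lie_add, hy, hy']
    | zero => rw [lie_zero, map_zero, lie_zero]
    | tmul l y hy d =>
      rw [LieAlgebra.ExtendScalars.bracket_tmul, hσ k x hx, hσ l y hy,
        LieAlgebra.ExtendScalars.bracket_tmul, hσ (k + l) _ (AdGrading.lie_lie_of_eigen hx hy),
        mul_add, ← Laurent.tPow_mul_tPow, mul_mul_mul_comm]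

lemma comp_apply (G : AdGrading h) (hσ : IsRhoAction h m σ) (d : ℤ) (x : Laurent ⊗[ℂ] L) :
    G.comp Laurent d (σ x) = σ (G.comp Laurent d x) := by
  induction x using G.induction_eigen with
  | add x x' hx hx' => simp only [map_add, hx, hx']
  | zero => simp only [map_zero]
  | tmul k x hx c =>
    rw [hσ k x hx, G.comp_one_tmul_of_lie hx, G.comp_one_tmul_of_lie hx]
    split_ifs
    · rw [hσ k x hx]
    · rw [map_zero]

lemma mem_filt (G : AdGrading h) (hσ : IsRhoAction h m σ) {k : ℤ} {x : Laurent ⊗[ℂ] L}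
    (hx : x ∈ G.filt Laurent k) : σ x ∈ G.filt Laurent k :=
  G.mem_filt.2 fun j hj => by rw [hσ.comp_apply G, G.mem_filt.1 hx j hj, map_zero]

lemma isUnipotent_conj {G : AdGrading h} (hσ : IsRhoAction h m σ) {k : ℤ}
    {s : (Laurent ⊗[ℂ] L) ≃ₗ[Laurent] (Laurent ⊗[ℂ] L)} (hs : G.IsUnipotent k s) :
    G.IsUnipotent k (σ * (s * σ⁻¹)) where
  map_lie x y := by
    simp only [LinearEquiv.mul_apply, hσ.inv.map_lie G, hs.map_lie, hσ.map_lie G]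
  sub_mem d x hx := by
    have h1 : σ (σ⁻¹ x) = x := by rw [← LinearEquiv.mul_apply, mul_inv_cancel]; rfl
    have h2 : (σ * (s * σ⁻¹)) x - x = σ (s (σ⁻¹ x) - σ⁻¹ x) := by
      rw [map_sub, h1]
      rfl
    rw [h2]
    exact hσ.mem_filt G (hs.sub_mem d _ (hσ.inv.mem_filt G hx))

/-- Conjugation by `ρ(t)ⁿ` adds `- n ρ / t`. -/
lemma isGauge (G : AdGrading h) (hσ : IsRhoAction h m σ) (a : Laurent ⊗[ℂ] L) :
    IsGauge σ a (σ a - (m : ℂ) • (tPow (-1) ⊗ₜ h)) := by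
  refine (isGauge_iff (hσ.map_lie G)).2 fun z => ?_
  rw [sub_sub_cancel_left]
  induction z using G.induction_eigen with
  | add z z' hz hz' =>
    simp only [map_add, lie_add, hz, hz']
    abel
  | zero => simp only [map_zero, lie_zero, add_zero]
  | tmul k x hx c =>
    rw [LinearMap.rTensor_tmul, hσ k x hx, hσ k x hx, LinearMap.rTensor_tmul,
      Laurent.ddt_tPow_mul, neg_lie, TensorProduct.smul_tmul',
      LieAlgebra.ExtendScalars.bracket_tmul, hx, TensorProduct.tmul_smul,
      TensorProduct.smul_tmul', sub_eq_add_neg, add_comm (m * k) (-1), ← Laurent.tPow_mul_tPow,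
      smul_mul_assoc, smul_smul, mul_assoc, ← TensorProduct.neg_tmul, ← TensorProduct.add_tmul]
    congr 1
    push_cast
    rw [mul_comm (k : ℂ)]
    abel

lemma apply_of_lie_eq_zero (G : AdGrading h) (hσ : IsRhoAction h m σ) {z : Laurent ⊗[ℂ] L}
    (hz : ⁅(1 : Laurent) ⊗ₜ[ℂ] h, z⁆ = 0) : σ z = z := by
  have h0 : ∀ d : ℤ, d ≠ 0 → G.comp Laurent d z = 0 := by
    intro d hd
    have := G.comp_lie_left d z
    rw [hz, map_zero, eq_comm, smul_eq_zero_iff_right (by exact_mod_cast hd)] at this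
    exact this
  rw [← G.sum_comp z, map_sum]
  refine Finset.sum_congr rfl fun d _ => ?_
  by_cases hd : d = 0
  · subst hd
    generalize z = w
    induction w with
    | zero => simp only [map_zero]
    | add x y hx hy => simp only [map_add, hx, hy]
    | tmul c x =>
      rw [G.comp_tmul, hσ 0 _ (G.lie_proj 0 x), mul_zero, Laurent.tPow_zero, one_mul]
  · rw [h0 d hd, map_zero]

lemma isGauge_singPart (G : AdGrading h) {n : ℕ} (hn : 1 ≤ n) (hσ : IsRhoAction h n σ)
    (hp : ⁅h, p⁆ = -p) {w : PowerSeries ℂ ⊗[ℂ] L}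
    (hw : ⁅(1 : PowerSeries ℂ) ⊗ₜ[ℂ] h, w⁆ = 0) :
    IsGauge σ (1 ⊗ₜ p + tPow (-n) • toLaurent L w)
      (singPart n p (w - (PowerSeries.X ^ (n - 1)) ⊗ₜ[ℂ] ((n : ℂ) • h))) := by
  have hw' : ⁅(1 : Laurent) ⊗ₜ[ℂ] h, tPow (-n) • toLaurent L w⁆ = 0 := by
    rw [lie_smul, ← toLaurent_one_tmul, toLaurent, ← rTensor_lie, hw, map_zero, smul_zero]
  convert hσ.isGauge G (1 ⊗ₜ p + tPow (-n) • toLaurent L w) using 1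
  rw [map_add, hσ.apply_of_lie_eq_zero G hw', hσ (-1) p (by simpa using hp), singPart, map_sub,
    smul_add, smul_sub, add_sub_assoc, TensorProduct.smul_tmul', smul_eq_mul, mul_neg_one]
  congr 2
  rw [toLaurent, LinearMap.rTensor_tmul, AlgHom.toLinearMap_apply, Laurent.ofPowerSeries_X_pow,
    TensorProduct.smul_tmul', smul_eq_mul, Laurent.tPow_mul_tPow, TensorProduct.tmul_smul]
  congr 3
  lia

end IsRhoAction

end Cocharacter

/-! ### The residue of the Miura transformation -/

section Miura

open LieAlgebra LieAlgebra.IsKilling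

variable {g : Type*} [LieRing g] [LieAlgebra ℂ g] [FiniteDimensional ℂ g] [IsKilling ℂ g]
  {H : LieSubalgebra ℂ g} [H.IsCartanSubalgebra]
  {g' : Type*} [LieRing g'] [LieAlgebra ℂ g'] [FiniteDimensional ℂ g'] [IsKilling ℂ g']
  {H' : LieSubalgebra ℂ g'} [H'.IsCartanSubalgebra]
  {b : (rootSystem H).Base} {e : LanglandsDual H H'} {f : b.support → g'}

lemma rTensor_dualCartanOver {A B : Type*} [CommRing A] [Algebra ℂ A] [CommRing B] [Algebra ℂ B]
    (φ : A →ₗ[ℂ] B) (u : A ⊗[ℂ] Module.Dual ℂ H) :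
    LinearMap.rTensor g' φ (dualCartanOver e A u) =
      dualCartanOver e B (LinearMap.rTensor (Module.Dual ℂ H) φ u) := by
  rw [dualCartanOver, dualCartanOver, ← LinearMap.comp_apply, ← LinearMap.comp_apply,
    LinearMap.rTensor_comp_lTensor, LinearMap.lTensor_comp_rTensor]

lemma lie_dualCartanOver {A : Type*} [CommRing A] [Algebra ℂ A] {y : g'} (hy : y ∈ H')
    (u : A ⊗[ℂ] Module.Dual ℂ H) : ⁅(1 : A) ⊗ₜ[ℂ] y, dualCartanOver e A u⁆ = 0 := by
  induction u with
  | zero => rw [map_zero, lie_zero]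
  | add u v hu hv => rw [map_add, lie_add, hu, hv, add_zero]
  | tmul a x =>
    change ⁅(1 : A) ⊗ₜ[ℂ] y, a ⊗ₜ[ℂ] dualCartan e x⁆ = 0
    rw [LieAlgebra.ExtendScalars.bracket_tmul,
      lie_eq_zero_of_mem_cartan hy (dualCartan_mem e x), TensorProduct.tmul_zero]

lemma dualCartanOver_connOrd (n : ℕ) (u : PowerSeries ℂ ⊗[ℂ] Module.Dual ℂ H) :
    dualCartanOver e Laurent (connOrd n u) =
      tPow (-n) • toLaurent g' (dualCartanOver e (PowerSeries ℂ) u) := by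
  rw [toLaurent, rTensor_dualCartanOver, connOrd]
  exact ((dualCartan e).baseChange Laurent).map_smul _ _

variable (b e) in
/-- The Cartan part `u(t) - n ρ tⁿ⁻¹` of the representative of the Miura oper. -/
def miuraOrd (n : ℕ) (u : PowerSeries ℂ ⊗[ℂ] Module.Dual ℂ H) :
    (dualBorel b e).baseChange (PowerSeries ℂ) :=
  ⟨dualCartanOver e (PowerSeries ℂ) (u - (PowerSeries.X ^ (n - 1)) ⊗ₜ[ℂ] ((n : ℂ) • rho b)),
    dualCartanOver_mem b e _ _⟩

lemma ev_miuraOrd (n : ℕ) (u : PowerSeries ℂ ⊗[ℂ] Module.Dual ℂ H) :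
    ev n g' (miuraOrd b e n u).1 =
      dualCartanOver e (Jet n) (ev n (Module.Dual ℂ H) u - rhoJet b n) := by
  rw [miuraOrd, ev, rTensor_dualCartanOver, map_sub, ev, LinearMap.rTensor_tmul, rhoJet, jetT,
    AlgHom.toLinearMap_apply, map_pow]
  rfl

lemma isGauge_miuraOrd (hf : IsNegSimpleGenerators b e f) {n : ℕ} (hn : 1 ≤ n)
    (u : PowerSeries ℂ ⊗[ℂ] Module.Dual ℂ H)
    {σ : (Laurent ⊗[ℂ] g') ≃ₗ[Laurent] (Laurent ⊗[ℂ] g')}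
    (hσ : IsRhoAction (dualCartan e (rho b)) n σ) :
    IsGauge σ (1 ⊗ₜ pMinusOne b f + dualCartanOver e Laurent (connOrd n u))
      (singPart n (pMinusOne b f) (miuraOrd b e n u).1) := by
  obtain ⟨G⟩ := nonempty_adGrading_dualCartan_rho b e
  have h := hσ.isGauge_singPart G hn (lie_dualCartan_rho_pMinusOne hf)
    (lie_dualCartanOver (e := e) (dualCartan_mem e (rho b)) u)
  have h' : (miuraOrd b e n u).1 = dualCartanOver e (PowerSeries ℂ) u -
      (PowerSeries.X ^ (n - 1)) ⊗ₜ[ℂ] ((n : ℂ) • dualCartan e (rho b)) := by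
    rw [← map_smul]
    exact map_sub _ _ _
  rw [dualCartanOver_connOrd, h']
  exact h

/-- All representatives of an oper with singularity which is mapped to the Miura oper have the
residue of the standard one. -/
lemma toJetAdjointQuotient_eq_of_mapsTo (hf : IsNegSimpleGenerators b e f) {n : ℕ} (hn : 1 ≤ n)
    (u : PowerSeries ℂ ⊗[ℂ] Module.Dual ℂ H) {O : OperOrd b e f n}
    (hO : O.MapsTo b e f n (miura b e f (connOrd n u)))
    (x : (dualBorel b e).baseChange (PowerSeries ℂ))
    (hx : (Quotient.mk _ x : OperOrd b e f n) = O) :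
    toJetAdjointQuotient n (1 ⊗ₜ pMinusOne b f + ev n g' x.1) =
      toJetAdjointQuotient n (1 ⊗ₜ pMinusOne b f + ev n g' (miuraOrd b e n u).1) := by
  obtain ⟨G⟩ := nonempty_adGrading_dualCartan_rho b e
  obtain ⟨x', y, σ, rfl, hy, hσ, hg⟩ := hO
  obtain ⟨s, hs, hsg⟩ := Quotient.exact hx
  obtain ⟨s', hs', hsg'⟩ := Quotient.exact hy
  have hu : G.IsUnipotent 1 s := G.isUnipotent_of_mem_expGroup (by
    rintro _ ⟨z, hz, rfl⟩
    exact G.rTensor_mem_filt _ (G.dualNil_le e _ hz)) hs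
  have hu' : G.IsUnipotent 1 s' := G.isUnipotent_of_mem_expGroup (G.dualNil_le e _) hs'
  exact G.toJetAdjointQuotient_eq_of_isGauge
    (fun z hz => by
      have : z ∈ LieAlgebra.center ℂ g' :=
        (LieModule.mem_maxTrivSubmodule _ _ _ z).2 fun y => by rw [← lie_skew, hz, neg_zero]
      simpa using this)
    (lie_dualCartan_rho_pMinusOne hf)
    (fun k hk z hz hzp => eq_zero_of_lie_pMinusOne_eq_zero hf hk hz hzp) n
    (G.dualBorel_le e _ x.2) (G.dualBorel_le e _ (miuraOrd b e n u).2)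
    ((hσ.isUnipotent_conj hu').mul zero_le_one hu)
    (hsg.trans ((hg.symm.trans hsg').trans (isGauge_miuraOrd hf hn u hσ)))

lemma canonicallyIdentified (n : ℕ) (x : Jet n ⊗[ℂ] Module.Dual ℂ H) :
    CanonicallyIdentified e n (toJetAdjointQuotient n (dualCartanOver e (Jet n) x))
      (varpi n x) := by
  intro P hP
  obtain ⟨F, hF⟩ := exists_jet_coefficients (generatedByNilpotents H') n hP
  exact ⟨⟨_, pullback_dualCartan_mem_weylInvariants e hP⟩, F, rfl, hF,
    (PolyFun.evalAt_pullback _ x P).trans (hF _)⟩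

end Miura

end IrregularOpers

end

open IrregularOpers in
theorem lemma3p1
    {g : Type*} [LieRing g] [LieAlgebra ℂ g] [FiniteDimensional ℂ g] [LieAlgebra.IsSimple ℂ g]
    (H : LieSubalgebra ℂ g) [H.IsCartanSubalgebra]
    (b : (LieAlgebra.IsKilling.rootSystem H).Base)
    {g' : Type*} [LieRing g'] [LieAlgebra ℂ g'] [FiniteDimensional ℂ g']
    [LieAlgebra.IsSimple ℂ g']
    (H' : LieSubalgebra ℂ g') [H'.IsCartanSubalgebra]
    (e : LanglandsDual H H')
    (f : b.support → g') (hf : IsNegSimpleGenerators b e f)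
    (n : ℕ) (hn : 1 ≤ n)
    (u : TensorProduct ℂ (PowerSeries ℂ) (Module.Dual ℂ H)) :
    (∃ O : OperOrd b e f n, O.MapsTo b e f n (miura b e f (connOrd n u))) ∧
    ∀ O : OperOrd b e f n, O.MapsTo b e f n (miura b e f (connOrd n u)) →
      ∃ χ : JetAdjointQuotient g' n,
        OperOrd.IsResidue b e f n O χ ∧
        χ = toJetAdjointQuotient n
          (dualCartanOver e (Jet n) (ev n (Module.Dual ℂ H) u - rhoJet b n)) ∧
        CanonicallyIdentified e n χ (varpi n (ev n (Module.Dual ℂ H) u - rhoJet b n)) := by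
  obtain ⟨G⟩ := nonempty_adGrading_dualCartan_rho b e
  refine ⟨⟨Quotient.mk _ (miuraOrd b e n u), miuraOrd b e n u, _, G.cochar n, rfl, rfl,
    G.isRhoAction_cochar n, isGauge_miuraOrd hf hn u (G.isRhoAction_cochar n)⟩,
    fun O hO => ⟨_, fun x hx => ?_, rfl, canonicallyIdentified n _⟩⟩
  rw [toJetAdjointQuotient_eq_of_mapsTo hf hn u hO x hx, ev_miuraOrd]
  exact toJetAdjointQuotient_add_eq (generatedByNilpotents H') n
    (lie_dualCartan_rho_pMinusOne hf) (lie_dualCartanOver (dualCartan_mem e (rho b)) _)
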